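/- Let $f,g$ be real polynomials with $\deg f\le 2$, $\deg g\le 1$, let $I\subseteq\mathbb R$ be a nonempty open interval (bounded or unbounded) with $f>0$ on $I$ and $f=0$ at the finite end points of $I$, and let $V$ be a real function, differentiable on $I$, satisfying the Pearson equation $2V'=g/f$ on $I$. (This covers the Hermite, Laguerre, Jacobi and generalised Cauchy weights $e^{-2V}$.) Put $V_1=V+\tfrac12\log f$, $V_2=V-\tfrac12\log f$, and for polynomials $\phi,\psi$ $$\langle\phi,\psi\rangle_{1,V_1}=\tfrac12\iint_{I\times I}\phi(y)\psi(z)\,\mathrm{sgn}(z-y)e^{-V_1(y)-V_1(z)}\,dy\,dz,\qquad \langle\phi,\psi\rangle_{2,V}=\int_I\phi\psi\, e^{-2V}dz,$$ $$\langle\phi,\psi\rangle_{4,V_2}=\tfrac12\int_I(\phi\psi'-\phi'\psi)e^{-2V_2}dz .$$ Let $N\in\{0,1,2,\dots\}\cup\{\infty\}$ be such that $\int_I x^{2n}e^{-2V(x)}dx<\infty$ for all integers $0\le n\le N$, and let $p_n$ ($0\le n\le N$) be the monic polynomials, $\deg p_n=n$, with $\langle p_m,p_n\rangle_{2,V}=0$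 for $m\neq n$; put $h_n=\langle p_n,p_n\rangle_{2,V}$ and $p_{-1}=0$. (For Hermite, Laguerre and Jacobi weights one may take $N=\infty$; for the generalised Cauchy weight $N$ is finite.) Then the integrals defining $\langle p_m,p_n\rangle_{1,V_1}$ and $\langle p_m,p_n\rangle_{4,V_2}$ converge absolutely for all $m,n\le N$. There are real sequences $a_n,b_n,c_n$ such that the structure relation $$f p_n'=a_np_{n+1}+b_np_n+c_np_{n-1}\qquad(0\le n\le N)$$ holds, where, if $N$ is finite and $n=N$, the symbol $p_{N+1}$ stands for some monic polynomial of degree $N+1$ orthogonal (with respect to $\langle\cdot,\cdot\rangle_{2,V}$) to $p_k$ for all $k<N$. Moreover, with $h^{(4)}_j=\tfrac12(c_{j+1}h_j-a_jh_{j+1})$ for integers $0\le j<N$, there are real sequences $\zeta_n,h^{(1)}_n$ such that $$\langle p_{2m},\,p_{2n+1}-\zeta_np_{2n-1}\rangle_{1,V_1}=h^{(1)}_n\delta_{n,m},$$ $$\langle p_{2m},p_{2n}\rangle_{1,V_1}=\langle p_{2n+1}-\zeta_np_{2n-1},\,p_{2m+1}-\zeta_mp_{2m-1}\rangle_{1,V_1}=0,$$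 $$\langle p_{2m},p_{2n+1}\rangle_{4,V_2}=h^{(4)}_{2n}\delta_{n,m}-h^{(4)}_{2m-1}\delta_{m-1,n},$$ $$\langle p_{2m},p_{2n}\rangle_{4,V_2}=\langle p_{2m+1},p_{2n+1}\rangle_{4,V_2}=0$$ for all integers $m,n\ge0$ for which the indices of the leading polynomials $p_{2m},p_{2m+1},p_{2n},p_{2n+1}$ occurring in the respective relation are at most $N$ (the second term of the third relation is $0$ for $m=0$). -/

import Mathlib

open Polynomial MeasureTheory Set

noncomputable section

namespace ClassicalSkew

/-- `e^{-2V}` is a weight of Pearson type on the interval `I`: `I` is a nonempty open interval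
(bounded or not) on which `f > 0` and at whose finite end points `f = 0`, and
`2 V' = g / f` on `I` with `deg g ≤ 1`, `deg f ≤ 2`. -/
structure IsPearsonWeight (f g : ℝ[X]) (V : ℝ → ℝ) (I : Set ℝ) : Prop where
  isOpen : IsOpen I
  ordConnected : I.OrdConnected
  nonempty : I.Nonempty
  natDegree_f : f.natDegree ≤ 2
  natDegree_g : g.natDegree ≤ 1
  f_pos : ∀ x ∈ I, 0 < f.eval x
  f_frontier : ∀ x ∈ frontier I, f.eval x = 0
  differentiable : ∀ x ∈ I, DifferentiableAt ℝ V x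
  pearson : ∀ x ∈ I, 2 * deriv V x = g.eval x / f.eval x

/-- The potential `V₁ = V + ½ log f`. -/
def V₁ (f : ℝ[X]) (V : ℝ → ℝ) : ℝ → ℝ := fun x => V x + 1 / 2 * Real.log (f.eval x)

/-- The potential `V₂ = V - ½ log f`. -/
def V₂ (f : ℝ[X]) (V : ℝ → ℝ) : ℝ → ℝ := fun x => V x - 1 / 2 * Real.log (f.eval x)

/-- Integrand of the `β = 1` skew inner product, at the point `(y, z)`. -/
def integrand₁ (V : ℝ → ℝ) (φ ψ : ℝ[X]) (s : ℝ × ℝ) : ℝ :=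
  φ.eval s.1 * ψ.eval s.2 * Real.sign (s.2 - s.1) * Real.exp (-V s.1 - V s.2)

/-- The skew inner product `⟨φ, ψ⟩_{1,V}` on `I`. -/
def inner₁ (I : Set ℝ) (V : ℝ → ℝ) (φ ψ : ℝ[X]) : ℝ :=
  1 / 2 * ∫ s in I ×ˢ I, integrand₁ V φ ψ s

/-- The inner product `⟨φ, ψ⟩_{2,V}` on `I`. -/
def inner₂ (I : Set ℝ) (V : ℝ → ℝ) (φ ψ : ℝ[X]) : ℝ :=
  ∫ z in I, φ.eval z * ψ.eval z * Real.exp (-2 * V z)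

/-- Integrand of the `β = 4` skew inner product. -/
def integrand₄ (V : ℝ → ℝ) (φ ψ : ℝ[X]) (z : ℝ) : ℝ :=
  (φ.eval z * (derivative ψ).eval z - (derivative φ).eval z * ψ.eval z) * Real.exp (-2 * V z)

/-- The skew inner product `⟨φ, ψ⟩_{4,V}` on `I`. -/
def inner₄ (I : Set ℝ) (V : ℝ → ℝ) (φ ψ : ℝ[X]) : ℝ :=
  1 / 2 * ∫ z in I, integrand₄ V φ ψ z

/-- `p₀, p₁, …` (all `p_n` with `n ≤ N`, where `N = ⊤` is allowed) are the monic orthogonal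
polynomials of the weight `e^{-2V}` on `I`; each of them is square integrable. -/
structure IsMonicOrthogonal (I : Set ℝ) (V : ℝ → ℝ) (N : ℕ∞) (p : ℕ → ℝ[X]) : Prop where
  monic : ∀ n : ℕ, (n : ℕ∞) ≤ N → (p n).Monic
  natDegree : ∀ n : ℕ, (n : ℕ∞) ≤ N → (p n).natDegree = n
  squareIntegrable : ∀ n : ℕ, (n : ℕ∞) ≤ N →
    IntegrableOn (fun x => x ^ (2 * n) * Real.exp (-2 * V x)) I
  orthogonal : ∀ m n : ℕ, (m : ℕ∞) ≤ N → (n : ℕ∞) ≤ N → m ≠ n → inner₂ I V (p m) (p n) = 0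

/-- `prev p n = p_{n-1}`, with the convention `p_{-1} = 0`. -/
def prev (p : ℕ → ℝ[X]) : ℕ → ℝ[X]
  | 0 => 0
  | n + 1 => p n

/-- The structure relation `f p_n' = a_n p_{n+1} + b_n p_n + c_n p_{n-1}` for all `n ≤ N`.
Here `q` is `p_{n+1}` whenever `n + 1 ≤ N`. For finite `N` and `n = N` there is no `p_{n+1}` in the
family, and `q` is a monic polynomial of degree `n + 1` orthogonal to `p_k` for all `k < n`. -/
def StructureRelation (f : ℝ[X]) (I : Set ℝ) (V : ℝ → ℝ) (N : ℕ∞) (p : ℕ → ℝ[X])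
    (a b c : ℕ → ℝ) : Prop :=
  ∀ n : ℕ, (n : ℕ∞) ≤ N → ∃ q : ℝ[X],
    q.Monic ∧ q.natDegree = n + 1 ∧ (∀ k < n, inner₂ I V q (p k) = 0) ∧
    (((n + 1 : ℕ) : ℕ∞) ≤ N → q = p (n + 1)) ∧
    f * derivative (p n) = C (a n) * q + C (b n) * p n + C (c n) * prev p n

/-- The odd polynomial `p_{2n+1} - ζ_n p_{2n-1}`. -/
def oddPoly (p : ℕ → ℝ[X]) (ζ : ℕ → ℝ) (n : ℕ) : ℝ[X] :=
  p (2 * n + 1) - C (ζ n) * prev p (2 * n)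

/-- The relations, for all polynomials in the family `p_k`, `k ≤ N`, between a family of polynomials
and two skew inner products `s₁`, `s₄`. The sequence `h₄` enters through its values at natural
numbers only: the term `h₄_{2m-1} δ_{m-1,n}` is zero unless `m = n + 1`. -/
structure SkewRelations (s₁ s₄ : ℝ[X] → ℝ[X] → ℝ) (N : ℕ∞) (p : ℕ → ℝ[X])
    (ζ h₁ h₄ : ℕ → ℝ) : Prop where
  even_odd₁ : ∀ m n : ℕ, ((2 * m : ℕ) : ℕ∞) ≤ N → ((2 * n + 1 : ℕ) : ℕ∞) ≤ N →
    s₁ (p (2 * m)) (oddPoly p ζ n) = if n = m then h₁ n else 0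
  even_even₁ : ∀ m n : ℕ, ((2 * m : ℕ) : ℕ∞) ≤ N → ((2 * n : ℕ) : ℕ∞) ≤ N →
    s₁ (p (2 * m)) (p (2 * n)) = 0
  odd_odd₁ : ∀ m n : ℕ, ((2 * m + 1 : ℕ) : ℕ∞) ≤ N → ((2 * n + 1 : ℕ) : ℕ∞) ≤ N →
    s₁ (oddPoly p ζ n) (oddPoly p ζ m) = 0
  even_odd₄ : ∀ m n : ℕ, ((2 * m : ℕ) : ℕ∞) ≤ N → ((2 * n + 1 : ℕ) : ℕ∞) ≤ N →
    s₄ (p (2 * m)) (p (2 * n + 1)) =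
      (if n = m then h₄ (2 * n) else 0) - (if m = n + 1 then h₄ (2 * m - 1) else 0)
  even_even₄ : ∀ m n : ℕ, ((2 * m : ℕ) : ℕ∞) ≤ N → ((2 * n : ℕ) : ℕ∞) ≤ N →
    s₄ (p (2 * m)) (p (2 * n)) = 0
  odd_odd₄ : ∀ m n : ℕ, ((2 * m + 1 : ℕ) : ℕ∞) ≤ N → ((2 * n + 1 : ℕ) : ℕ∞) ≤ N →
    s₄ (p (2 * m + 1)) (p (2 * n + 1)) = 0

end ClassicalSkew

end

/-! Write `w = e^{-2V}` and `T = skewOp f g`, that is `T ψ = f ψ' + ½ (f' - g) ψ`. Since `e^{-V₂} =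
f e^{-V₁}` on `I`, the Pearson equation reads `(e^{-V₂} ψ)' = e^{-V₁} T ψ`; it also gives `(f φ w)'
= (f φ' + (f' - g) φ) w`. Once boundary terms vanish, the first identity inverts the sign kernel,
`⟨φ, T ψ⟩₁ = -⟨φ, ψ⟩₂` (`inner₁_skewOp`), and the second makes `T` antisymmetric for `⟨·,·⟩₂`
(`moment_skewOp_mul`).

As `T` raises degrees by at most one, antisymmetry forces `T p_n = α p_{n+1} + γ p_{n-1}`. Here `α ≠
0`: otherwise the integral of `f (p_n p_{n+1}' - p_n' p_{n+1}) w` would vanish, while this Wronskian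
is positive (`exists_skewOp`, `wronskian_pos`). With `ζ_n = -γ/α` the odd polynomial is `α⁻¹ T
p_{2n}`, so its `β = 1` pairings are orthogonality integrals against `p_{2n}`. Two even polynomials
pair to zero by induction, because `⟨φ, T p_{2m+1}⟩₁ = 0` for even `φ` in the family and `T
p_{2m+1}` links `p_{2m+2}` to `p_{2m}`. For `β = 4`, `e^{-2V₂} = f w`, and the structure relation
leaves only neighbouring indices.

The analytic difficulty is to get convergence and vanishing boundary terms from the available
moments alone. The functions in question have derivatives of eventually constant sign at an end.
Such a function tends to zero unless it stays away from zero, and then `log |x - e|`, which is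
unbounded there, would have an integrable derivative (`IsEnd.not_eventually_le_abs`,
`IsEnd.tendsto_zero`). So `e^{-V₂} ψ → 0`; being monotone near the end, it has an integrable
derivative `e^{-V₁} T ψ` there. A suitable `ψ` then dominates every `e^{-V₁} P` with `deg P ≤ n`.
Only an infinite end with quadratic `f` needs another argument, the inequality of arithmetic and
geometric means. -/

namespace ClassicalSkew

open Filter Topology Asymptotics

/-! ### Ends of an open interval, finite or infinite -/

/-- `l` is the filter of neighbourhoods, within `I`, of one of the two ends of `I`:
the left end for `σ = 1` and the right end for `σ = -1`. -/
structure IsEnd (I : Set ℝ) (l : Filter ℝ) (σ : ℝ) : Prop where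
  neBot : l.NeBot
  countable : l.IsCountablyGenerated
  sign : σ = 1 ∨ σ = -1
  basis : l.HasBasis (fun c => c ∈ I) (fun c => {x | x ∈ I ∧ 0 < σ * (c - x)})

/-- An open interval has no least element, so `atBot` on the subtype, pushed forward to `ℝ`,
describes its left end uniformly, whether finite or infinite. -/
theorem isEnd_left {I : Set ℝ} (ho : IsOpen I) (hc : I.OrdConnected) (hne : I.Nonempty) :
    IsEnd I (map ((↑) : I → ℝ) atBot) 1 := by
  have := hc
  have : Nonempty I := hne.to_subtype
  have : NoMinOrder I := ⟨fun a => by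
    obtain ⟨l, hl, h⟩ := exists_Ioc_subset_of_mem_nhds (ho.mem_nhds a.2) ⟨a.1 - 1, by linarith⟩
    have : (l + a.1) / 2 ∈ I := h ⟨by linarith, by linarith⟩
    exact ⟨⟨_, this⟩, by rw [← Subtype.coe_lt_coe]; show (l + a.1) / 2 < a.1; linarith⟩⟩
  refine ⟨inferInstance, inferInstance, Or.inl rfl, ?_⟩
  refine ((atBot_basis_Iio (α := I)).map ((↑) : I → ℝ)).to_hasBasis ?_ ?_
  · rintro c -
    refine ⟨c, c.2, ?_⟩
    rintro x ⟨hx, h⟩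
    exact ⟨⟨x, hx⟩, by rw [mem_Iio, ← Subtype.coe_lt_coe]; show x < c; linarith, rfl⟩
  · rintro c hcI
    refine ⟨⟨c, hcI⟩, trivial, ?_⟩
    rintro _ ⟨x, hx, rfl⟩
    rw [mem_Iio, ← Subtype.coe_lt_coe] at hx
    exact ⟨x.2, by simp only at hx; linarith⟩

theorem isEnd_right {I : Set ℝ} (ho : IsOpen I) (hc : I.OrdConnected) (hne : I.Nonempty) :
    IsEnd I (map ((↑) : I → ℝ) atTop) (-1) := by
  have := hc
  have : Nonempty I := hne.to_subtype
  have : NoMaxOrder I := ⟨fun a => by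
    obtain ⟨l, hl, h⟩ := exists_Ico_subset_of_mem_nhds (ho.mem_nhds a.2) ⟨a.1 + 1, by linarith⟩
    have : (l + a.1) / 2 ∈ I := h ⟨by linarith, by linarith⟩
    exact ⟨⟨_, this⟩, by rw [← Subtype.coe_lt_coe]; show a.1 < (l + a.1) / 2; linarith⟩⟩
  refine ⟨inferInstance, inferInstance, Or.inr rfl, ?_⟩
  refine ((atTop_basis_Ioi (α := I)).map ((↑) : I → ℝ)).to_hasBasis ?_ ?_
  · rintro c -
    refine ⟨c, c.2, ?_⟩
    rintro x ⟨hx, h⟩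
    exact ⟨⟨x, hx⟩, by rw [mem_Ioi, ← Subtype.coe_lt_coe]; show (c : ℝ) < x; linarith, rfl⟩
  · rintro c hcI
    refine ⟨⟨c, hcI⟩, trivial, ?_⟩
    rintro _ ⟨x, hx, rfl⟩
    rw [mem_Ioi, ← Subtype.coe_lt_coe] at hx
    exact ⟨x.2, by simp only at hx; linarith⟩

namespace IsEnd

variable {I : Set ℝ} {l : Filter ℝ} {σ : ℝ}

theorem mem (h : IsEnd I l σ) : I ∈ l := by
  have := h.neBot
  obtain ⟨c, hc⟩ := h.basis.ex_mem
  exact mem_of_superset (h.basis.mem_of_mem hc) fun x hx => hx.1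

theorem beyond (h : IsEnd I l σ) {c : ℝ} (hc : c ∈ I) : ∀ᶠ x in l, 0 < σ * (c - x) :=
  mem_of_superset (h.basis.mem_of_mem hc) fun _ hx => hx.2

theorem ordConnected_beyond (h : IsEnd I l σ) (hI : I.OrdConnected) (c : ℝ) :
    {x | x ∈ I ∧ 0 < σ * (c - x)}.OrdConnected := by
  refine ⟨fun x hx y hy z hz => ⟨hI.out hx.1 hy.1 hz, ?_⟩⟩
  rcases h.sign with rfl | rfl
  · have := hy.2; have := hz.2; linarith
  · have := hx.2; have := hz.1; linarith

theorem isOpen_beyond (hI : IsOpen I) (c : ℝ) : IsOpen {x | x ∈ I ∧ 0 < σ * (c - x)} :=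
  hI.inter (isOpen_lt continuous_const (continuous_const.mul (continuous_const.sub continuous_id)))

theorem tendstoIxx (h : IsEnd I l σ) (hI : I.OrdConnected) : TendstoIxxClass Icc l l :=
  h.basis.tendstoIxxClass fun c _ _ hx _ hy => (h.ordConnected_beyond hI c).out hx hy

theorem isMeasurablyGenerated (h : IsEnd I l σ) (hI : IsOpen I) : l.IsMeasurablyGenerated :=
  ⟨fun s hs => by
    obtain ⟨c, hc, hcs⟩ := h.basis.mem_iff.1 hs
    exact ⟨_, h.basis.mem_of_mem hc, (isOpen_beyond hI c).measurableSet, hcs⟩⟩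

/-- A point of `I` near the end beyond which a given eventual property holds. -/
theorem exists_forall (h : IsEnd I l σ) {P : ℝ → Prop} (hP : ∀ᶠ x in l, P x) :
    ∃ c ∈ I, ∀ x ∈ I, 0 < σ * (c - x) → P x := by
  obtain ⟨c, hc, hcs⟩ := h.basis.mem_iff.1 hP
  exact ⟨c, hc, fun x hx hxc => hcs ⟨hx, hxc⟩⟩

theorem kind_left (ho : IsOpen I) (h : IsEnd I l 1) :
    (∃ e ∈ frontier I, l ≤ 𝓝[≠] e ∧ ∀ᶠ x in l, 0 < x - e) ∨ l ≤ cocompact ℝ := by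
  have hne : I.Nonempty := by have := h.neBot; exact h.basis.ex_mem
  by_cases hb : BddBelow I
  · left
    have hlt : ∀ x ∈ I, sInf I < x := by
      intro x hx
      refine lt_of_le_of_ne (csInf_le hb hx) fun he => ?_
      obtain ⟨r, hr, hs⟩ := exists_Ioc_subset_of_mem_nhds (ho.mem_nhds hx) ⟨x - 1, by linarith⟩
      have := csInf_le hb (hs (⟨by linarith, by linarith⟩ : (r + x) / 2 ∈ Ioc r x))
      linarith
    refine ⟨sInf I, ⟨csInf_mem_closure hne hb, ?_⟩, ?_, ?_⟩
    · rw [ho.interior_eq]; exact fun hx => (hlt _ hx).false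
    · rw [nhdsWithin, le_inf_iff, le_principal_iff]
      constructor
      · refine (nhds_basis_Ioo (sInf I)).ge_iff.2 ?_
        rintro ⟨a, b⟩ ⟨ha, hb'⟩
        obtain ⟨c, hc, hcb⟩ := exists_lt_of_csInf_lt hne hb'
        filter_upwards [h.mem, h.beyond hc] with x hx hxc
        exact ⟨ha.trans (hlt x hx), by dsimp only at hcb ⊢; linarith⟩
      · filter_upwards [h.mem] with x hx
        exact (hlt x hx).ne'
    · filter_upwards [h.mem] with x hx
      linarith [hlt x hx]
  · right
    refine le_trans ?_ (atBot_le_cocompact)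
    refine atBot_basis.ge_iff.2 fun b _ => ?_
    rw [not_bddBelow_iff] at hb
    obtain ⟨c, hc, hcb⟩ := hb b
    filter_upwards [h.beyond hc] with x hxc
    rw [mem_Iic]; linarith

theorem kind_right (ho : IsOpen I) (h : IsEnd I l (-1)) :
    (∃ e ∈ frontier I, l ≤ 𝓝[≠] e ∧ ∀ᶠ x in l, 0 < -(x - e)) ∨ l ≤ cocompact ℝ := by
  have hne : I.Nonempty := by have := h.neBot; exact h.basis.ex_mem
  by_cases hb : BddAbove I
  · left
    have hlt : ∀ x ∈ I, x < sSup I := by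
      intro x hx
      refine lt_of_le_of_ne (le_csSup hb hx) fun he => ?_
      obtain ⟨r, hr, hs⟩ := exists_Ico_subset_of_mem_nhds (ho.mem_nhds hx) ⟨x + 1, by linarith⟩
      have := le_csSup hb (hs (⟨by linarith, by linarith⟩ : (r + x) / 2 ∈ Ico x r))
      linarith
    refine ⟨sSup I, ⟨csSup_mem_closure hne hb, ?_⟩, ?_, ?_⟩
    · rw [ho.interior_eq]; exact fun hx => (hlt _ hx).false
    · rw [nhdsWithin, le_inf_iff, le_principal_iff]
      constructor
      · refine (nhds_basis_Ioo (sSup I)).ge_iff.2 ?_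
        rintro ⟨a, b⟩ ⟨ha, hb'⟩
        obtain ⟨c, hc, hcb⟩ := exists_lt_of_lt_csSup hne ha
        filter_upwards [h.mem, h.beyond hc] with x hx hxc
        exact ⟨by dsimp only at hcb ⊢; linarith, (hlt x hx).trans hb'⟩
      · filter_upwards [h.mem] with x hx
        exact (hlt x hx).ne
    · filter_upwards [h.mem] with x hx
      linarith [hlt x hx]
  · right
    refine le_trans ?_ (atTop_le_cocompact)
    refine atTop_basis.ge_iff.2 fun b _ => ?_
    rw [not_bddAbove_iff] at hb
    obtain ⟨c, hc, hcb⟩ := hb b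
    filter_upwards [h.beyond hc] with x hxc
    rw [mem_Ici]; linarith

/-- An end of an open interval is a finite frontier point or it is infinite. -/
theorem kind (ho : IsOpen I) (h : IsEnd I l σ) :
    (∃ e ∈ frontier I, l ≤ 𝓝[≠] e ∧ ∀ᶠ x in l, 0 < σ * (x - e)) ∨ l ≤ cocompact ℝ := by
  rcases h.sign with rfl | rfl
  · simpa using h.kind_left ho
  · simpa using h.kind_right ho

/-! ### Decay at an end from monotonicity and the divergence of the logarithm -/

theorem tendsto_log_nhdsNE (e : ℝ) :
    Tendsto (fun x => ‖Real.log (x - e)‖) (𝓝[≠] e) atTop := by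
  have h : Tendsto (fun x => x - e) (𝓝[≠] e) (𝓝[≠] 0) := by
    refine tendsto_nhdsWithin_iff.2 ⟨?_, ?_⟩
    · have : Tendsto (fun x => x - e) (𝓝 e) (𝓝 (e - e)) := by
        exact (continuous_id.sub continuous_const).tendsto e
      rw [sub_self] at this
      exact this.mono_left nhdsWithin_le_nhds
    · filter_upwards [self_mem_nhdsWithin] with x hx
      exact sub_ne_zero.2 hx
  exact tendsto_abs_atBot_atTop.comp (Real.tendsto_log_nhdsNE_zero.comp h)

theorem tendsto_log_cocompact (e : ℝ) :
    Tendsto (fun x => ‖Real.log (x - e)‖) (cocompact ℝ) atTop := by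
  have h1 : Tendsto (fun x : ℝ => ‖x‖ - ‖e‖) (cocompact ℝ) atTop :=
    tendsto_atTop_add_const_right _ _ (tendsto_norm_cocompact_atTop)
  have h2 : Tendsto (fun x : ℝ => ‖x - e‖) (cocompact ℝ) atTop :=
    tendsto_atTop_mono (fun x => norm_sub_norm_le x e) h1
  have h3 := tendsto_abs_atTop_atTop.comp (Real.tendsto_log_atTop.comp h2)
  refine h3.congr fun x => ?_
  simp [Real.log_abs]

/-- Near an end, a function is not bounded away from zero if it is `O((x - e) G)` with
`G` integrable. -/
theorem not_eventually_le_abs (h : IsEnd I l σ) (hI : I.OrdConnected) {e : ℝ}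
    (he : l ≤ 𝓝[≠] e ∨ l ≤ cocompact ℝ) {F G : ℝ → ℝ} (hG : IntegrableOn G I)
    (hF : (fun x => F x * (x - e)⁻¹) =O[l] G) {δ : ℝ} (hδ : 0 < δ) :
    ¬ ∀ᶠ x in l, δ ≤ |F x| := by
  intro hδF
  have := h.neBot
  have := h.tendstoIxx hI
  have hlog : Tendsto (fun x => ‖Real.log (x - e)‖) l atTop := by
    rcases he with he | he
    · exact (tendsto_log_nhdsNE e).mono_left he
    · exact (tendsto_log_cocompact e).mono_left he
  have hne : ∀ᶠ x in l, x - e ≠ 0 := by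
    filter_upwards [hlog.eventually_gt_atTop 0] with x hx hx0
    simp [hx0] at hx
  -- If `|F| ≥ δ`, the derivative `(x - e)⁻¹` of `log (x - e)` is `O(F (x - e)⁻¹)`, hence `O(G)`; an
  -- unbounded function cannot have a derivative dominated by an integrable one.
  refine not_integrableOn_of_tendsto_norm_atTop_of_deriv_isBigO_filter l h.mem
    (f := fun x => Real.log (x - e)) ?_ hlog ?_ hG
  · filter_upwards [hne] with x hx
    exact ((differentiableAt_id.sub_const e).log hx)
  · refine IsBigO.trans ?_ hF
    refine IsBigO.of_bound δ⁻¹ ?_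
    filter_upwards [hne, hδF] with x hx hxF
    have : deriv (fun x => Real.log (x - e)) x = (x - e)⁻¹ := by
      have := (((hasDerivAt_id x).sub_const e).log hx).deriv
      simpa using this
    rw [this, norm_mul, Real.norm_eq_abs (F x), ← mul_assoc]
    have h1 : 1 ≤ δ⁻¹ * |F x| := by
      rw [inv_mul_eq_div, le_div_iff₀ hδ]; linarith
    calc ‖(x - e)⁻¹‖ = 1 * ‖(x - e)⁻¹‖ := (one_mul _).symm
      _ ≤ _ := by gcongr

/-- If `F` varies monotonically towards an end then it increases there, in absolute terms. -/
theorem exists_monotone (h : IsEnd I l σ) (hI : I.OrdConnected) {F F' : ℝ → ℝ}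
    (hF : ∀ x ∈ I, HasDerivAt F (F' x) x) (hs : ∀ᶠ x in l, σ * F' x ≤ 0) :
    ∃ c₀ ∈ I, ∀ c ∈ I, ∀ x ∈ I, 0 < σ * (c₀ - c) → 0 < σ * (c - x) → F c ≤ F x := by
  obtain ⟨c₀, hc₀, H⟩ := h.exists_forall hs
  refine ⟨c₀, hc₀, fun c hc x hx hcc hxc => ?_⟩
  have hxx : 0 < σ * (c₀ - x) := by nlinarith
  have hA := h.ordConnected_beyond hI c₀
  have hd : ∀ y ∈ {x | x ∈ I ∧ 0 < σ * (c₀ - x)}, deriv F y = F' y := fun y hy =>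
    (hF y hy.1).deriv
  have hcont : ContinuousOn F {x | x ∈ I ∧ 0 < σ * (c₀ - x)} := fun y hy =>
    (hF y hy.1).continuousAt.continuousWithinAt
  have hdiff : DifferentiableOn ℝ F (interior {x | x ∈ I ∧ 0 < σ * (c₀ - x)}) := fun y hy =>
    (hF y (interior_subset hy).1).differentiableAt.differentiableWithinAt
  rcases h.sign with rfl | rfl
  · refine antitoneOn_of_deriv_nonpos hA.convex hcont hdiff (fun y hy => ?_) ⟨hx, hxx⟩ ⟨hc, hcc⟩
      (by linarith)
    have hy' := interior_subset hy
    rw [hd y hy']; have := H y hy'.1 hy'.2; linarith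
  · refine monotoneOn_of_deriv_nonneg hA.convex hcont hdiff (fun y hy => ?_) ⟨hc, hcc⟩ ⟨hx, hxx⟩
      (by linarith)
    have hy' := interior_subset hy
    rw [hd y hy']; have := H y hy'.1 hy'.2; linarith

theorem exists_near (h : IsEnd I l σ) {c₀ : ℝ} (hc₀ : c₀ ∈ I) {P : ℝ → Prop}
    (hP : ∃ᶠ x in l, P x) : ∃ c ∈ I, 0 < σ * (c₀ - c) ∧ P c := by
  obtain ⟨c, hc⟩ := (hP.and_eventually (Filter.inter_mem h.mem (h.beyond hc₀))).exists
  exact ⟨c, hc.2.1, hc.2.2, hc.1⟩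

/-- Here `F` increases towards the end. A positive value would persist as a lower bound for `|F|`,
so `F ≤ 0` near the end; a value close to zero, which must occur arbitrarily far out, then traps all
later values. -/
theorem tendsto_zero_aux (h : IsEnd I l σ) (hI : I.OrdConnected) {F F' : ℝ → ℝ}
    (hF : ∀ x ∈ I, HasDerivAt F (F' x) x) (hs : ∀ᶠ x in l, σ * F' x ≤ 0)
    (hδ : ∀ δ > 0, ¬ ∀ᶠ x in l, δ ≤ |F x|) : Tendsto F l (𝓝 0) := by
  have := h.neBot
  obtain ⟨c₀, hc₀, H⟩ := h.exists_monotone hI hF hs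
  have hnp : ∀ c ∈ I, 0 < σ * (c₀ - c) → F c ≤ 0 := by
    intro c hc hcc
    by_contra! hpos
    refine hδ (F c) hpos ?_
    filter_upwards [h.mem, h.beyond hc] with x hx hxc
    exact (H c hc x hx hcc hxc).trans (le_abs_self _)
  rw [Metric.tendsto_nhds]
  intro ε hε
  obtain ⟨c, hc, hcc, hcε⟩ := h.exists_near hc₀ (P := fun x => ¬ ε ≤ |F x|)
    (fun hh => hδ ε hε (hh.mono fun x hx => not_not.1 hx))
  rw [not_le, abs_lt] at hcε
  filter_upwards [h.mem, h.beyond hc, h.beyond hc₀] with x hx hxc hxc₀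
  rw [Real.dist_eq, sub_zero, abs_lt]
  have h1 := H c hc x hx hcc hxc
  have h2 := hnp x hx hxc₀
  constructor <;> linarith

/-- A function which varies monotonically near an end, and is not bounded away from zero there,
tends to zero. -/
theorem tendsto_zero (h : IsEnd I l σ) (hI : I.OrdConnected) {F F' : ℝ → ℝ}
    (hF : ∀ x ∈ I, HasDerivAt F (F' x) x)
    (hs : (∀ᶠ x in l, 0 ≤ F' x) ∨ (∀ᶠ x in l, F' x ≤ 0))
    (hδ : ∀ δ > 0, ¬ ∀ᶠ x in l, δ ≤ |F x|) : Tendsto F l (𝓝 0) := by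
  have hs' : (∀ᶠ x in l, σ * F' x ≤ 0) ∨ (∀ᶠ x in l, σ * -F' x ≤ 0) := by
    rcases h.sign with rfl | rfl
    · exact hs.symm.imp (fun H => H.mono fun x hx => by linarith)
        (fun H => H.mono fun x hx => by linarith)
    · exact hs.imp (fun H => H.mono fun x hx => by linarith)
        (fun H => H.mono fun x hx => by linarith)
  rcases hs' with hs' | hs'
  · exact h.tendsto_zero_aux hI hF hs' hδ
  · have := h.tendsto_zero_aux hI (F := fun x => -F x) (fun x hx => (hF x hx).neg) hs'
      (by simpa only [abs_neg] using hδ)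
    simpa using this.neg

/-- A function which is not bounded away from zero near an end cannot increase towards it
from positive values. -/
theorem not_eventually_sign_le (h : IsEnd I l σ) (hI : I.OrdConnected)
    {F F' : ℝ → ℝ} (hF : ∀ x ∈ I, HasDerivAt F (F' x) x) (hpos : ∃ᶠ x in l, 0 < F x)
    (hδ : ∀ δ > 0, ¬ ∀ᶠ x in l, δ ≤ |F x|) : ¬ ∀ᶠ x in l, σ * F' x ≤ 0 := by
  intro hs
  obtain ⟨c₀, hc₀, H⟩ := h.exists_monotone hI hF hs
  obtain ⟨c, hc, hcc, hcp⟩ := h.exists_near hc₀ hpos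
  refine hδ (F c) hcp ?_
  filter_upwards [h.mem, h.beyond hc] with x hx hxc
  exact (H c hc x hx hcc hxc).trans (le_abs_self _)

end IsEnd

/-! ### Integrability of derivatives and the fundamental theorem of calculus up to an end -/

/-- The derivative of a bounded monotone function is integrable. -/
theorem integrableOn_of_bounded_of_nonneg {S : Set ℝ} (hS : IsOpen S) (hc : S.OrdConnected)
    {H H' : ℝ → ℝ} (hH : ∀ x ∈ S, HasDerivAt H (H' x) x) (h0 : ∀ x ∈ S, 0 ≤ H' x)
    (hm : AEStronglyMeasurable H' (volume.restrict S)) {C : ℝ} (hC : ∀ x ∈ S, |H x| ≤ C) :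
    IntegrableOn H' S := by
  have hmono : MonotoneOn H S := by
    refine monotoneOn_of_deriv_nonneg hc.convex
      (fun y hy => (hH y hy).continuousAt.continuousWithinAt)
      (fun y hy => (hH y (interior_subset hy)).differentiableAt.differentiableWithinAt)
      fun y hy => ?_
    rw [(hH y (interior_subset hy)).deriv]
    exact h0 y (interior_subset hy)
  -- For monotone `H` the lower integral of `H'` is the length of the image of `H`, which lies in
  -- `[-C, C]`; no integrability is needed beforehand.
  have key := lintegral_deriv_eq_volume_image_of_monotoneOn hS.measurableSet
    (fun x hx => (hH x hx).hasDerivWithinAt) hmono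
  refine ⟨hm, ?_⟩
  rw [hasFiniteIntegral_iff_ofReal ((ae_restrict_iff' hS.measurableSet).2 (ae_of_all _ h0)), key]
  refine lt_of_le_of_lt (measure_mono (t := Icc (-C) C) ?_) (by simp)
  rintro _ ⟨x, hx, rfl⟩
  exact abs_le.1 (hC x hx)

theorem integrableOn_of_bounded_of_sign {S : Set ℝ} (hS : IsOpen S) (hc : S.OrdConnected)
    {H H' : ℝ → ℝ} (hH : ∀ x ∈ S, HasDerivAt H (H' x) x)
    (h0 : (∀ x ∈ S, 0 ≤ H' x) ∨ (∀ x ∈ S, H' x ≤ 0))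
    (hm : AEStronglyMeasurable H' (volume.restrict S)) {C : ℝ} (hC : ∀ x ∈ S, |H x| ≤ C) :
    IntegrableOn H' S := by
  rcases h0 with h0 | h0
  · exact integrableOn_of_bounded_of_nonneg hS hc hH h0 hm hC
  · have := integrableOn_of_bounded_of_nonneg hS hc (H := fun x => -H x) (H' := fun x => -H' x)
      (fun x hx => (hH x hx).neg) (fun x hx => by linarith [h0 x hx]) hm.neg
      (fun x hx => by rw [abs_neg]; exact hC x hx)
    simpa using this.neg

namespace IsEnd

variable {I : Set ℝ} {l : Filter ℝ} {σ : ℝ}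

theorem integrableAtFilter_deriv (h : IsEnd I l σ) (ho : IsOpen I) (hI : I.OrdConnected)
    {H H' : ℝ → ℝ} (hH : ∀ x ∈ I, HasDerivAt H (H' x) x)
    (hs : (∀ᶠ x in l, 0 ≤ H' x) ∨ (∀ᶠ x in l, H' x ≤ 0)) (hcont : ContinuousOn H' I)
    (hlim : Tendsto H l (𝓝 0)) : IntegrableAtFilter H' l := by
  have hb : ∀ᶠ x in l, |H x| ≤ 1 := by
    have := (tendsto_order.1 (tendsto_zero_iff_abs_tendsto_zero _ |>.1 hlim)).2 1 one_pos
    exact this.mono fun x hx => le_of_lt hx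
  have key : ∀ c : ℝ, AEStronglyMeasurable H' (volume.restrict {x | x ∈ I ∧ 0 < σ * (c - x)}) :=
    fun c => (hcont.mono fun x hx => hx.1).aestronglyMeasurable (isOpen_beyond ho c).measurableSet
  rcases hs with hs | hs
  · obtain ⟨c, hc, hP⟩ := h.exists_forall (hs.and hb)
    exact ⟨_, h.basis.mem_of_mem hc, integrableOn_of_bounded_of_sign (isOpen_beyond ho c)
      (h.ordConnected_beyond hI c) (fun x hx => hH x hx.1)
      (Or.inl fun x hx => (hP x hx.1 hx.2).1) (key c) (fun x hx => (hP x hx.1 hx.2).2)⟩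
  · obtain ⟨c, hc, hP⟩ := h.exists_forall (hs.and hb)
    exact ⟨_, h.basis.mem_of_mem hc, integrableOn_of_bounded_of_sign (isOpen_beyond ho c)
      (h.ordConnected_beyond hI c) (fun x hx => hH x hx.1)
      (Or.inr fun x hx => (hP x hx.1 hx.2).1) (key c) (fun x hx => (hP x hx.1 hx.2).2)⟩

/-- A nonzero polynomial does not vanish near an end. -/
theorem eventually_eval_ne_zero (h : IsEnd I l σ) (ho : IsOpen I) {P : ℝ[X]} (hP : P ≠ 0) :
    ∀ᶠ x in l, P.eval x ≠ 0 := by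
  have hfin : {x | P.eval x = 0}.Finite := by
    refine (P.roots.toFinset.finite_toSet).subset fun x hx => ?_
    simpa [hP] using hx
  rcases h.kind ho with ⟨e, -, he, -⟩ | he
  · refine he ?_
    have : ({x | P.eval x = 0} \ {e})ᶜ ∈ 𝓝 e :=
      (hfin.subset sdiff_subset).isClosed.isOpen_compl.mem_nhds (by simp)
    filter_upwards [mem_nhdsWithin_of_mem_nhds this, self_mem_nhdsWithin] with x hx hxe hx0
    exact hx ⟨hx0, hxe⟩
  · exact he (hfin.isCompact.compl_mem_cocompact)

/-- Beyond its last root a polynomial keeps its sign, by the intermediate value theorem. This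
supplies the monotonicity required by `tendsto_zero`. -/
theorem eventually_eval_sign (h : IsEnd I l σ) (ho : IsOpen I) (hI : I.OrdConnected) (P : ℝ[X]) :
    (∀ᶠ x in l, 0 ≤ P.eval x) ∨ (∀ᶠ x in l, P.eval x ≤ 0) := by
  by_cases hP : P = 0
  · simp [hP]
  obtain ⟨c, hc, hne⟩ := h.exists_forall (h.eventually_eval_ne_zero ho hP)
  have hpre := (h.ordConnected_beyond hI c).isPreconnected
  by_cases hall : ∀ x ∈ {x | x ∈ I ∧ 0 < σ * (c - x)}, 0 ≤ P.eval x
  · exact Or.inl (mem_of_superset (h.basis.mem_of_mem hc) hall)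
  · right
    push Not at hall
    obtain ⟨a, ha, hpa⟩ := hall
    refine mem_of_superset (h.basis.mem_of_mem hc) fun b hb => ?_
    by_contra! hpb
    obtain ⟨z, hz, hz0⟩ := hpre.intermediate_value ha hb P.continuous.continuousOn
      (⟨hpa.le, le_of_lt (not_le.1 hpb)⟩ : (0 : ℝ) ∈ Icc _ _)
    exact hne z hz.1 hz.2 hz0

end IsEnd

theorem integrableOn_of_ends {I : Set ℝ} {l r : Filter ℝ} (hI : I.OrdConnected)
    (hl : IsEnd I l 1) (hr : IsEnd I r (-1)) {F : ℝ → ℝ} (hc : ContinuousOn F I)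
    (hFl : IntegrableAtFilter F l) (hFr : IntegrableAtFilter F r) : IntegrableOn F I := by
  obtain ⟨A, hA, hAF⟩ := hFl
  obtain ⟨B, hB, hBF⟩ := hFr
  obtain ⟨a, ha, haA⟩ := hl.exists_forall hA
  obtain ⟨b, hb, hbB⟩ := hr.exists_forall hB
  have hm : IntegrableOn F (Icc a b) :=
    (hc.mono (hI.out ha hb)).integrableOn_Icc
  refine ((hAF.union hm).union hBF).mono_set fun x hx => ?_
  by_cases h1 : x < a
  · exact Or.inl (Or.inl (haA x hx (by linarith)))
  by_cases h2 : b < x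
  · exact Or.inr (hbB x hx (by linarith))
  exact Or.inl (Or.inr ⟨not_lt.1 h1, not_lt.1 h2⟩)

/-- Cutting `I` at an interior point `y` allows one argument for finite and infinite ends: the
intervals `Ioc y b` exhaust the half of `I` beyond `y` as `b` runs to the end. -/
theorem setIntegral_deriv_Ioi {I : Set ℝ} {r : Filter ℝ} (ho : IsOpen I) (hI : I.OrdConnected)
    (hr : IsEnd I r (-1)) {H H' : ℝ → ℝ} (hH : ∀ x ∈ I, HasDerivAt H (H' x) x)
    (hint : IntegrableOn H' I) (hlim : Tendsto H r (𝓝 0)) {y : ℝ} (hy : y ∈ I) :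
    ∫ z in I ∩ Ioi y, H' z = -H y := by
  have := hr.countable
  have := hr.neBot
  have hm : MeasurableSet (I ∩ Ioi y) := ho.measurableSet.inter measurableSet_Ioi
  have hcov : AECover (volume.restrict (I ∩ Ioi y)) r (fun b => Ioc y b) :=
    { ae_eventually_mem := by
        refine (ae_restrict_iff' hm).2 (ae_of_all _ fun x hx => ?_)
        filter_upwards [hr.beyond hx.1] with b hb
        exact ⟨hx.2, by linarith⟩
      measurableSet := fun b => measurableSet_Ioc }
  have h1 := hcov.integral_tendsto_of_countably_generated (f := H') (hint.mono_set inter_subset_left)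
  have h2 : ∀ᶠ b in r, ∫ x in Ioc y b, H' x ∂(volume.restrict (I ∩ Ioi y)) = H b - H y := by
    filter_upwards [hr.mem, hr.beyond hy] with b hb hyb
    have hyb' : y ≤ b := by linarith
    have hsub : Icc y b ⊆ I := hI.out hy hb
    rw [Measure.restrict_restrict measurableSet_Ioc,
      inter_eq_left.2 (show Ioc y b ⊆ I ∩ Ioi y from fun x hx => ⟨hsub ⟨hx.1.le, hx.2⟩, hx.1⟩),
      ← intervalIntegral.integral_of_le hyb']
    refine intervalIntegral.integral_eq_sub_of_hasDerivAt (fun x hx => hH x (hsub ?_)) ?_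
    · rwa [uIcc_of_le hyb'] at hx
    · rw [intervalIntegrable_iff_integrableOn_Icc_of_le hyb']
      exact hint.mono_set hsub
  have h3 : Tendsto (fun b => H b - H y) r (𝓝 (0 - H y)) := hlim.sub_const _
  rw [zero_sub] at h3
  exact tendsto_nhds_unique h1 (h3.congr' (h2.mono fun b hb => hb.symm))

theorem setIntegral_deriv_Iio {I : Set ℝ} {l : Filter ℝ} (ho : IsOpen I) (hI : I.OrdConnected)
    (hl : IsEnd I l 1) {H H' : ℝ → ℝ} (hH : ∀ x ∈ I, HasDerivAt H (H' x) x)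
    (hint : IntegrableOn H' I) (hlim : Tendsto H l (𝓝 0)) {y : ℝ} (hy : y ∈ I) :
    ∫ z in I ∩ Iic y, H' z = H y := by
  have := hl.countable
  have := hl.neBot
  have hm : MeasurableSet (I ∩ Iic y) := ho.measurableSet.inter measurableSet_Iic
  have hcov : AECover (volume.restrict (I ∩ Iic y)) l (fun b => Ioc b y) :=
    { ae_eventually_mem := by
        refine (ae_restrict_iff' hm).2 (ae_of_all _ fun x hx => ?_)
        filter_upwards [hl.beyond hx.1] with b hb
        exact ⟨by linarith, hx.2⟩
      measurableSet := fun b => measurableSet_Ioc }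
  have h1 := hcov.integral_tendsto_of_countably_generated (f := H') (hint.mono_set inter_subset_left)
  have h2 : ∀ᶠ b in l, ∫ x in Ioc b y, H' x ∂(volume.restrict (I ∩ Iic y)) = H y - H b := by
    filter_upwards [hl.mem, hl.beyond hy] with b hb hyb
    have hyb' : b ≤ y := by linarith
    have hsub : Icc b y ⊆ I := hI.out hb hy
    rw [Measure.restrict_restrict measurableSet_Ioc,
      inter_eq_left.2 (show Ioc b y ⊆ I ∩ Iic y from fun x hx => ⟨hsub ⟨hx.1.le, hx.2⟩, hx.2⟩),
      ← intervalIntegral.integral_of_le hyb']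
    refine intervalIntegral.integral_eq_sub_of_hasDerivAt (fun x hx => hH x (hsub ?_)) ?_
    · rwa [uIcc_of_le hyb'] at hx
    · rw [intervalIntegrable_iff_integrableOn_Icc_of_le hyb']
      exact hint.mono_set hsub
  have h3 : Tendsto (fun b => H y - H b) l (𝓝 (H y - 0)) := hlim.const_sub _
  rw [sub_zero] at h3
  exact tendsto_nhds_unique h1 (h3.congr' (h2.mono fun b hb => hb.symm))

theorem isBigO_eval_cocompact {P Q : ℝ[X]} (hQ : Q ≠ 0) (h : P.natDegree ≤ Q.natDegree) :
    (fun x => P.eval x) =O[cocompact ℝ] fun x => Q.eval x := by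
  have top : ∀ {P Q : ℝ[X]}, Q ≠ 0 → P.natDegree ≤ Q.natDegree →
      (fun x => P.eval x) =O[atTop] fun x => Q.eval x := fun {P Q} hQ h =>
    isBigO_atTop_of_degree_le P Q <| by
      rw [degree_eq_natDegree hQ]; exact degree_le_of_natDegree_le h
  rw [cocompact_eq_atBot_atTop, isBigO_sup]
  refine ⟨?_, top hQ h⟩
  have hn : ∀ P : ℝ[X], (P.comp (-X)).natDegree = P.natDegree := fun P => by
    rw [natDegree_comp, natDegree_neg, natDegree_X, mul_one]
  have hQ' : Q.comp (-X) ≠ 0 := fun h0 => hQ <| by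
    have := congrArg (fun R : ℝ[X] => R.comp (-X)) h0
    simpa [comp_assoc] using this
  have := (top hQ' (by rw [hn, hn]; exact h : (P.comp (-X)).natDegree ≤ _)).comp_tendsto
    tendsto_neg_atBot_atTop
  simpa [Function.comp_def] using this

/-! ### The Pearson weight and its first order operator -/

/-- The first order operator `ψ ↦ f ψ' + ½ (f' - g) ψ`. -/
noncomputable def skewOp (f g ψ : ℝ[X]) : ℝ[X] :=
  f * derivative ψ + C (1 / 2) * (derivative f - g) * ψ

/-- Moments of order `0` and `2 n` exist. -/
def HasMoments (I : Set ℝ) (V : ℝ → ℝ) (n : ℕ) : Prop :=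
  IntegrableOn (fun x => Real.exp (-2 * V x)) I ∧
    IntegrableOn (fun x => x ^ (2 * n) * Real.exp (-2 * V x)) I

/-- This is why moments of orders `0` and `2 n` control all polynomials of degree at most `2 n`. -/
theorem abs_pow_le_one_add {n k : ℕ} (hk : k ≤ 2 * n) (x : ℝ) : |x| ^ k ≤ 1 + x ^ (2 * n) := by
  have h2 : x ^ (2 * n) = |x| ^ (2 * n) := by rw [pow_mul, pow_mul, sq_abs]
  rw [h2]
  rcases le_total |x| 1 with hx | hx
  · have := pow_le_one₀ (abs_nonneg x) hx (n := k)
    have : 0 ≤ |x| ^ (2 * n) := by positivity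
    linarith
  · have := pow_le_pow_right₀ hx hk
    linarith

theorem exists_abs_eval_le (P : ℝ[X]) {n : ℕ} (hP : P.natDegree ≤ 2 * n) :
    ∃ C : ℝ, ∀ x, |P.eval x| ≤ C * (1 + x ^ (2 * n)) := by
  refine ⟨∑ i ∈ Finset.range (2 * n + 1), |P.coeff i|, fun x => ?_⟩
  rw [eval_eq_sum_range' (n := 2 * n + 1) (by omega) x, Finset.sum_mul]
  refine (Finset.abs_sum_le_sum_abs _ _).trans (Finset.sum_le_sum fun i hi => ?_)
  rw [abs_mul, abs_pow]
  have := abs_pow_le_one_add (n := n) (k := i) (by rw [Finset.mem_range] at hi; omega) x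
  gcongr

/-- The square root of the Pearson weight divided by `f`. -/
noncomputable def weightDiv (f : ℝ[X]) (V : ℝ → ℝ) (x : ℝ) : ℝ := Real.exp (-V₁ f V x)

/-- The square root of the Pearson weight multiplied by `f`. -/
noncomputable def weightMul (f : ℝ[X]) (V : ℝ → ℝ) (x : ℝ) : ℝ := Real.exp (-V₂ f V x)

namespace IsPearsonWeight

variable {f g : ℝ[X]} {V : ℝ → ℝ} {I : Set ℝ}

theorem weightDiv_mul_weightMul (f : ℝ[X]) (V : ℝ → ℝ) (x : ℝ) :
    weightDiv f V x * weightMul f V x = Real.exp (-2 * V x) := by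
  rw [weightDiv, weightMul, ← Real.exp_add, V₁, V₂]
  congr 1; ring

theorem weightMul_eq (hV : IsPearsonWeight f g V I) {x : ℝ} (hx : x ∈ I) :
    weightMul f V x = f.eval x * weightDiv f V x := by
  rw [weightDiv, weightMul, V₁, V₂]
  conv_rhs => rw [← Real.exp_log (hV.f_pos x hx), ← Real.exp_add]
  rw [Real.log_exp]
  congr 1; ring

theorem exp_V₂_eq (hV : IsPearsonWeight f g V I) {x : ℝ} (hx : x ∈ I) :
    Real.exp (-2 * V₂ f V x) = f.eval x * Real.exp (-2 * V x) := by
  rw [← weightDiv_mul_weightMul f V x, ← mul_assoc, ← hV.weightMul_eq hx, weightMul,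
    ← Real.exp_add]
  congr 1; ring

theorem exp_eq (hV : IsPearsonWeight f g V I) {x : ℝ} (hx : x ∈ I) :
    Real.exp (-2 * V x) = f.eval x * weightDiv f V x ^ 2 := by
  rw [← weightDiv_mul_weightMul f V x, hV.weightMul_eq hx]; ring

theorem weightMul_sq (hV : IsPearsonWeight f g V I) {x : ℝ} (hx : x ∈ I) :
    weightMul f V x ^ 2 = f.eval x * Real.exp (-2 * V x) := by
  rw [hV.exp_eq hx, hV.weightMul_eq hx]; ring

theorem hasDerivAt_V (hV : IsPearsonWeight f g V I) {x : ℝ} (hx : x ∈ I) :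
    HasDerivAt V (g.eval x / f.eval x / 2) x := by
  have h := (hV.differentiable x hx).hasDerivAt
  have h2 := hV.pearson x hx
  have he : deriv V x = g.eval x / f.eval x / 2 := by linarith
  rwa [he] at h

theorem hasDerivAt_exp (hV : IsPearsonWeight f g V I) {x : ℝ} (hx : x ∈ I) :
    HasDerivAt (fun x => Real.exp (-2 * V x))
      (-(g.eval x / f.eval x) * Real.exp (-2 * V x)) x := by
  have := ((hV.hasDerivAt_V hx).const_mul (-2)).exp
  refine this.congr_deriv ?_
  ring

/-- The factor `f` cancels the denominator of `2 V' = g / f`, so the derivative is again a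
polynomial times the weight. -/
theorem hasDerivAt_mul_exp (hV : IsPearsonWeight f g V I) (φ : ℝ[X]) {x : ℝ} (hx : x ∈ I) :
    HasDerivAt (fun x => (f * φ).eval x * Real.exp (-2 * V x))
      ((f * derivative φ + (derivative f - g) * φ).eval x * Real.exp (-2 * V x)) x := by
  have := ((f * φ).hasDerivAt x).mul (hV.hasDerivAt_exp hx)
  refine this.congr_deriv ?_
  have hf := (hV.f_pos x hx).ne'
  simp only [derivative_mul, eval_add, eval_mul, eval_sub]
  field_simp
  ring

/-- This identity is the reason for the definition of `skewOp`: it turns the `β = 1` weight times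
`skewOp f g ψ` into an exact derivative. -/
theorem hasDerivAt_weightMul_mul (hV : IsPearsonWeight f g V I) (ψ : ℝ[X]) {x : ℝ} (hx : x ∈ I) :
    HasDerivAt (fun x => weightMul f V x * ψ.eval x)
      (weightDiv f V x * (skewOp f g ψ).eval x) x := by
  have hf := (hV.f_pos x hx).ne'
  have h1 := (hV.hasDerivAt_V hx).sub (((f.hasDerivAt x).log hf).const_mul (1 / 2))
  have := h1.neg.exp.mul (ψ.hasDerivAt x)
  refine this.congr_deriv ?_
  have hw : Real.exp (-(V - fun y => 1 / 2 * Real.log (eval y f)) x) = weightMul f V x := rfl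
  simp only [Pi.neg_apply, hw]
  rw [hV.weightMul_eq hx]
  simp only [skewOp, eval_add, eval_mul, eval_sub, eval_C]
  field_simp
  ring

theorem continuousOn_V (hV : IsPearsonWeight f g V I) : ContinuousOn V I := fun x hx =>
  (hV.differentiable x hx).continuousAt.continuousWithinAt

theorem continuousOn_weightDiv (hV : IsPearsonWeight f g V I) :
    ContinuousOn (weightDiv f V) I := by
  have h : ContinuousOn (fun x => Real.log (f.eval x)) I :=
    f.continuous.continuousOn.log fun x hx => (hV.f_pos x hx).ne'
  have hc := hV.continuousOn_V
  unfold weightDiv V₁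
  fun_prop

theorem continuousOn_exp (hV : IsPearsonWeight f g V I) :
    ContinuousOn (fun x => Real.exp (-2 * V x)) I := by
  have hc := hV.continuousOn_V
  fun_prop

theorem measurableSet (hV : IsPearsonWeight f g V I) : MeasurableSet I := hV.isOpen.measurableSet

theorem f_ne_zero (hV : IsPearsonWeight f g V I) : f ≠ 0 := by
  rintro rfl
  obtain ⟨x, hx⟩ := hV.nonempty
  simpa using hV.f_pos x hx

theorem integrableOn_eval_mul (hV : IsPearsonWeight f g V I) {n : ℕ} (hM : HasMoments I V n)
    {P : ℝ[X]} (hP : P.natDegree ≤ 2 * n) :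
    IntegrableOn (fun x => P.eval x * Real.exp (-2 * V x)) I := by
  obtain ⟨C, hC⟩ := exists_abs_eval_le P hP
  refine Integrable.mono' ((hM.1.add hM.2).const_mul C)
    ((P.continuous.continuousOn.mul hV.continuousOn_exp).aestronglyMeasurable hV.measurableSet)
    (ae_of_all _ fun x => ?_)
  rw [norm_mul, Real.norm_eq_abs, Real.norm_eq_abs, Real.abs_exp, Pi.add_apply]
  calc _ ≤ C * (1 + x ^ (2 * n)) * Real.exp (-2 * V x) := by gcongr; exact hC x
    _ = _ := by ring

/-- `f φ e^{-2V}` is not bounded away from zero near a finite end. -/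
theorem not_eventually_le_abs_finite (hV : IsPearsonWeight f g V I) {n : ℕ}
    (hM : HasMoments I V n) {l : Filter ℝ} {σ e : ℝ} (h : IsEnd I l σ) (he : l ≤ 𝓝[≠] e)
    (hfe : f.eval e = 0) (φ : ℝ[X]) {δ : ℝ} (hδ : 0 < δ) :
    ¬ ∀ᶠ x in l, δ ≤ |(f * φ).eval x * Real.exp (-2 * V x)| := by
  -- The zero of `f` at `e` absorbs the division by `x - e`, and what remains is bounded near `e`.
  obtain ⟨k, hk⟩ := dvd_iff_isRoot.2 hfe
  refine h.not_eventually_le_abs hV.ordConnected (Or.inl he) hM.1 ?_ hδ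
  have h1 : (fun x => (k * φ).eval x) =O[l] fun _ => (1 : ℝ) :=
    (((k * φ).continuous.tendsto e).mono_left (he.trans nhdsWithin_le_nhds)).isBigO_one ℝ
  have h2 := h1.mul (isBigO_refl (fun x => Real.exp (-2 * V x)) l)
  simp only [one_mul] at h2
  refine h2.congr' ?_ EventuallyEq.rfl
  filter_upwards [he self_mem_nhdsWithin] with x hx
  have hx' : x - e ≠ 0 := sub_ne_zero.2 hx
  rw [hk]
  simp only [eval_mul, eval_sub, eval_X, eval_C]
  field_simp

/-- Dividing by `x` lowers the degree to at most `2 n`, where the weight still has a moment; hence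
the bound `2 * n + 1`. -/
theorem not_eventually_le_abs_infinite (hV : IsPearsonWeight f g V I) {n : ℕ}
    (hM : HasMoments I V n) {l : Filter ℝ} {σ : ℝ} (h : IsEnd I l σ) (he : l ≤ cocompact ℝ)
    {φ : ℝ[X]} (hφ : (f * φ).natDegree ≤ 2 * n + 1) {δ : ℝ} (hδ : 0 < δ) :
    ¬ ∀ᶠ x in l, δ ≤ |(f * φ).eval x * Real.exp (-2 * V x)| := by
  refine h.not_eventually_le_abs hV.ordConnected (e := 0) (Or.inr he) hM.2 ?_ hδ
  have h1 : (fun x => (f * φ).eval x) =O[l] fun x => x ^ (2 * n + 1) := by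
    have := (isBigO_eval_cocompact (P := f * φ) (Q := X ^ (2 * n + 1)) (pow_ne_zero _ X_ne_zero)
      (by rwa [natDegree_X_pow])).mono he
    simpa using this
  have h2 := (h1.mul (isBigO_refl (fun x => x⁻¹ * Real.exp (-2 * V x)) l))
  refine h2.congr' (Eventually.of_forall fun x => ?_) ?_
  · simp only [sub_zero]; ring
  · have : ∀ᶠ x in l, x ≠ 0 := he (isCompact_singleton.compl_mem_cocompact)
    filter_upwards [this] with x hx
    field_simp
    ring

theorem not_eventually_le_abs (hV : IsPearsonWeight f g V I) {n : ℕ}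
    (hM : HasMoments I V n) {l : Filter ℝ} {σ : ℝ} (h : IsEnd I l σ)
    {φ : ℝ[X]} (hφ : (f * φ).natDegree ≤ 2 * n + 1) {δ : ℝ} (hδ : 0 < δ) :
    ¬ ∀ᶠ x in l, δ ≤ |(f * φ).eval x * Real.exp (-2 * V x)| := by
  rcases h.kind hV.isOpen with ⟨e, hef, he, -⟩ | he
  · exact hV.not_eventually_le_abs_finite hM h he (hV.f_frontier e hef) φ hδ
  · exact hV.not_eventually_le_abs_infinite hM h he hφ hδ

theorem tendsto_mul_exp (hV : IsPearsonWeight f g V I) {n : ℕ}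
    (hM : HasMoments I V n) {l : Filter ℝ} {σ : ℝ} (h : IsEnd I l σ)
    {φ : ℝ[X]} (hφ : (f * φ).natDegree ≤ 2 * n + 1) :
    Tendsto (fun x => (f * φ).eval x * Real.exp (-2 * V x)) l (𝓝 0) := by
  refine h.tendsto_zero hV.ordConnected (fun x hx => hV.hasDerivAt_mul_exp φ hx) ?_
    fun δ hδ => hV.not_eventually_le_abs hM h hφ hδ
  refine (h.eventually_eval_sign hV.isOpen hV.ordConnected
    (f * derivative φ + (derivative f - g) * φ)).imp (fun H => H.mono fun x hx => ?_)
      (fun H => H.mono fun x hx => ?_)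
  · exact mul_nonneg hx (Real.exp_pos _).le
  · exact mul_nonpos_of_nonpos_of_nonneg hx (Real.exp_pos _).le

/-! ### Local integrability of polynomials against `e^{-V₁}` -/

section LocalAnalysis

variable {l : Filter ℝ} {σ : ℝ} {ψ : ℝ[X]}

theorem eventually_skewOp_sign (hV : IsPearsonWeight f g V I) (h : IsEnd I l σ) (ψ : ℝ[X]) :
    (∀ᶠ x in l, 0 ≤ weightDiv f V x * (skewOp f g ψ).eval x) ∨
      (∀ᶠ x in l, weightDiv f V x * (skewOp f g ψ).eval x ≤ 0) :=
  (h.eventually_eval_sign hV.isOpen hV.ordConnected (skewOp f g ψ)).imp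
    (fun H => H.mono fun _ hx => mul_nonneg (Real.exp_pos _).le hx)
    (fun H => H.mono fun _ hx => mul_nonpos_of_nonneg_of_nonpos (Real.exp_pos _).le hx)

theorem tendsto_weightMul (hV : IsPearsonWeight f g V I) (h : IsEnd I l σ)
    (hψ : ∀ δ > 0, ¬ ∀ᶠ x in l, δ ≤ |(f * ψ ^ 2).eval x * Real.exp (-2 * V x)|) :
    Tendsto (fun x => weightMul f V x * ψ.eval x) l (𝓝 0) := by
  refine h.tendsto_zero hV.ordConnected (fun x hx => hV.hasDerivAt_weightMul_mul ψ hx)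
    (hV.eventually_skewOp_sign h ψ) fun δ hδ H => hψ (δ ^ 2) (by positivity) ?_
  filter_upwards [H, h.mem] with x hx hxI
  have : (f * ψ ^ 2).eval x * Real.exp (-2 * V x) = (weightMul f V x * ψ.eval x) ^ 2 := by
    rw [mul_pow, hV.weightMul_sq hxI, eval_mul, eval_pow]; ring
  rw [this, abs_pow]
  gcongr

theorem integrableAtFilter_skewOp (hV : IsPearsonWeight f g V I) (h : IsEnd I l σ)
    (hψ : ∀ δ > 0, ¬ ∀ᶠ x in l, δ ≤ |(f * ψ ^ 2).eval x * Real.exp (-2 * V x)|) :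
    IntegrableAtFilter (fun x => weightDiv f V x * (skewOp f g ψ).eval x) l :=
  h.integrableAtFilter_deriv hV.isOpen hV.ordConnected
    (fun _ hx => hV.hasDerivAt_weightMul_mul ψ hx) (hV.eventually_skewOp_sign h ψ)
    (hV.continuousOn_weightDiv.mul (skewOp f g ψ).continuous.continuousOn)
    (hV.tendsto_weightMul h hψ)

/-- The function `f ψ² e^{-2V}` is positive near the end and has derivative `2 ψ (skewOp f g ψ)
e^{-2V}`. The forbidden sign would make it increase towards the end, keeping it away from zero. -/
theorem not_eventually_skewOp_nonpos (hV : IsPearsonWeight f g V I) (h : IsEnd I l σ) (h0 : ψ ≠ 0)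
    (hψ : ∀ δ > 0, ¬ ∀ᶠ x in l, δ ≤ |(f * ψ ^ 2).eval x * Real.exp (-2 * V x)|) :
    ¬ ∀ᶠ x in l, σ * (ψ * skewOp f g ψ).eval x ≤ 0 := by
  have := h.neBot
  intro H
  refine h.not_eventually_sign_le hV.ordConnected (fun x hx => hV.hasDerivAt_mul_exp (ψ ^ 2) hx)
    (Eventually.frequently ?_) hψ ?_
  · filter_upwards [h.mem, h.eventually_eval_ne_zero hV.isOpen h0] with x hx hx0
    have := hV.f_pos x hx
    rw [eval_mul, eval_pow]
    positivity
  · filter_upwards [H] with x hx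
    have he : f * derivative (ψ ^ 2) + (derivative f - g) * ψ ^ 2 =
        C 2 * (ψ * skewOp f g ψ) := by
      have hC : (C 2 : ℝ[X]) * C (1 / 2) = 1 := by rw [← C_mul]; norm_num
      rw [skewOp, derivative_pow]
      simp only [Nat.cast_ofNat, Nat.add_one_sub_one, pow_one]
      linear_combination (-(derivative f - g) * ψ ^ 2) * hC
    rw [he, eval_mul, eval_C]
    have := Real.exp_pos (-2 * V x)
    have : σ * (2 * (ψ * skewOp f g ψ).eval x * Real.exp (-2 * V x)) =
      2 * Real.exp (-2 * V x) * (σ * (ψ * skewOp f g ψ).eval x) := by ring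
    rw [this]
    exact mul_nonpos_of_nonneg_of_nonpos (by positivity) hx

theorem skewOp_ne_zero_of_end (hV : IsPearsonWeight f g V I) (h : IsEnd I l σ) (h0 : ψ ≠ 0)
    (hψ : ∀ δ > 0, ¬ ∀ᶠ x in l, δ ≤ |(f * ψ ^ 2).eval x * Real.exp (-2 * V x)|) :
    skewOp f g ψ ≠ 0 := fun H =>
  hV.not_eventually_skewOp_nonpos h h0 hψ (by simp [H])

theorem stronglyMeasurableAtFilter (hV : IsPearsonWeight f g V I) (h : IsEnd I l σ) (P : ℝ[X]) :
    StronglyMeasurableAtFilter (fun x => weightDiv f V x * P.eval x) l :=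
  ⟨I, h.mem, (hV.continuousOn_weightDiv.mul P.continuous.continuousOn).aestronglyMeasurable
    hV.measurableSet⟩

theorem integrableAtFilter_of_isBigO (hV : IsPearsonWeight f g V I) (h : IsEnd I l σ)
    (hψ : ∀ δ > 0, ¬ ∀ᶠ x in l, δ ≤ |(f * ψ ^ 2).eval x * Real.exp (-2 * V x)|) {P : ℝ[X]}
    (hP : (fun x => P.eval x) =O[l] fun x => (skewOp f g ψ).eval x) :
    IntegrableAtFilter (fun x => weightDiv f V x * P.eval x) l := by
  have := h.isMeasurablyGenerated hV.isOpen
  exact ((isBigO_refl (weightDiv f V) l).mul hP).integrableAtFilter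
    (hV.stronglyMeasurableAtFilter h P) (hV.integrableAtFilter_skewOp h hψ)

theorem integrableAtFilter_infinite_of_two (hV : IsPearsonWeight f g V I) {n : ℕ}
    (hM : HasMoments I V n) (h : IsEnd I l σ) (he : l ≤ cocompact ℝ) (hf : 2 ≤ f.natDegree)
    {P : ℝ[X]} (hP : P.natDegree ≤ n) :
    IntegrableAtFilter (fun x => weightDiv f V x * P.eval x) l := by
  have := h.isMeasurablyGenerated hV.isOpen
  have h1 : IntegrableAtFilter (fun x => (P ^ 2).eval x * Real.exp (-2 * V x)) l :=
    ⟨I, h.mem, hV.integrableOn_eval_mul hM (natDegree_pow_le.trans (by omega))⟩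
  have hO : (fun x => (f.eval x)⁻¹) =O[l] fun x => (1 + x ^ 2)⁻¹ := by
    have hQ : (1 + X ^ 2 : ℝ[X]).natDegree = 2 := by compute_degree!
    have := (isBigO_eval_cocompact (P := 1 + X ^ 2) hV.f_ne_zero (by rw [hQ]; exact hf)).mono he
    refine IsBigO.inv_rev (by simpa using this) (Eventually.of_forall fun x hx => ?_)
    nlinarith [sq_nonneg x]
  have h2 : IntegrableAtFilter (fun x => (f.eval x)⁻¹) l := by
    refine hO.integrableAtFilter ⟨I, h.mem, ?_⟩ ⟨univ, univ_mem,
      integrable_inv_one_add_sq.integrableOn⟩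
    exact (f.continuous.continuousOn.inv₀ fun x hx => (hV.f_pos x hx).ne').aestronglyMeasurable
      hV.measurableSet
  refine IsBigO.integrableAtFilter (IsBigO.of_bound 1 ?_) (hV.stronglyMeasurableAtFilter h P)
    (h1.add h2)
  filter_upwards [h.mem] with x hx
  have hf0 := hV.f_pos x hx
  have hu : 0 < weightDiv f V x := Real.exp_pos _
  rw [Pi.add_apply, hV.exp_eq hx, eval_pow, one_mul, Real.norm_eq_abs, Real.norm_eq_abs]
  refine le_trans ?_ (le_abs_self _)
  set t := |weightDiv f V x * P.eval x| with ht
  have ht2 : P.eval x ^ 2 * (f.eval x * weightDiv f V x ^ 2) = f.eval x * t ^ 2 := by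
    rw [ht, sq_abs]; ring
  have ht0 : 0 ≤ t := abs_nonneg _
  rw [ht2]
  -- The arithmetic-geometric mean inequality `2 t ≤ f t² + 1/f`: the first term is `P² e^{-2V}`,
  -- and `1/f` is integrable at infinity because `f` is quadratic.
  have key : f.eval x * t ^ 2 + (f.eval x)⁻¹ - 2 * t = (f.eval x)⁻¹ * (f.eval x * t - 1) ^ 2 := by
    field_simp; ring
  have : 0 ≤ (f.eval x)⁻¹ * (f.eval x * t - 1) ^ 2 := by positivity
  linarith

theorem coeff_derivative_X_pow {n k : ℕ} (hk : n ≤ k) :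
    (derivative (X ^ n : ℝ[X])).coeff k = 0 := by
  rw [coeff_derivative, coeff_X_pow, if_neg (by omega), zero_mul]

/-- It suffices to find `ψ` of degree at most `n` for which `skewOp f g ψ` has degree at least `n`:
it then dominates `P` at infinity. The choice of `ψ` depends on whether `g` and `f` are constant. -/
theorem integrableAtFilter_infinite_of_one (hV : IsPearsonWeight f g V I) {n : ℕ}
    (hM : HasMoments I V n) (h : IsEnd I l σ) (he : l ≤ cocompact ℝ) (hf : f.natDegree ≤ 1)
    {P : ℝ[X]} (hP : P.natDegree ≤ n) :
    IntegrableAtFilter (fun x => weightDiv f V x * P.eval x) l := by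
  have hfe : f = C (f.coeff 1) * X + C (f.coeff 0) := eq_X_add_C_of_natDegree_le_one hf
  have hge : g = C (g.coeff 1) * X + C (g.coeff 0) := eq_X_add_C_of_natDegree_le_one hV.natDegree_g
  have hdf : derivative f = C (f.coeff 1) := by
    conv_lhs => rw [hfe]
    simp
  have hb : ∀ ψ : ℝ[X], ψ.natDegree ≤ n →
      ∀ δ > 0, ¬ ∀ᶠ x in l, δ ≤ |(f * ψ ^ 2).eval x * Real.exp (-2 * V x)| := by
    intro ψ hψ δ hδ
    refine hV.not_eventually_le_abs_infinite hM h he ?_ hδ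
    have h1 : (ψ ^ 2).natDegree ≤ 2 * ψ.natDegree := natDegree_pow_le
    have h2 := natDegree_mul_le (p := f) (q := ψ ^ 2)
    omega
  have hfin : ∀ ψ : ℝ[X], ψ.natDegree ≤ n → skewOp f g ψ ≠ 0 → n ≤ (skewOp f g ψ).natDegree →
      IntegrableAtFilter (fun x => weightDiv f V x * P.eval x) l := fun ψ hψ h0 hd =>
    hV.integrableAtFilter_of_isBigO h (hb ψ hψ)
      ((isBigO_eval_cocompact h0 (hP.trans hd)).mono he)
  by_cases hg1 : g.coeff 1 = 0
  · rw [hg1] at hge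
    by_cases hf1 : f.coeff 1 = 0
    · rw [hf1] at hfe
      -- If also `g = 0`, the operator would kill `ψ = 1`: a constant weight is not integrable at an
      -- infinite end.
      have hg0 : g.coeff 0 ≠ 0 := fun h0 => by
        refine hV.skewOp_ne_zero_of_end h one_ne_zero (hb 1 (by simp)) ?_
        rw [skewOp, hdf, hf1, hge, h0]; simp
      have hc : (skewOp f g (X ^ n)).coeff n ≠ 0 := by
        rw [skewOp, hdf, hf1, hge, hfe]
        simp only [C_0, zero_mul, zero_add, zero_sub, coeff_add, coeff_C_mul, ← C_neg, ← C_mul,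
          coeff_derivative_X_pow le_rfl, mul_zero, coeff_X_pow_self]
        simpa using hg0
      exact hfin (X ^ n) (by simp) (fun h0 => by simp [h0] at hc) (le_natDegree_of_ne_zero hc)
    · have hdeg : f.natDegree = 1 := le_antisymm hf (le_natDegree_of_ne_zero hf1)
      have hfn : (f ^ n).natDegree = n := by rw [natDegree_pow, hdeg, mul_one]
      -- For linear `f` and constant `g`, the power `f ^ n` is an eigenvector. Its eigenvalue is
      -- nonzero by `skewOp_ne_zero_of_end`, whereas the leading coefficient alone would not show
      -- this.
      have hs : skewOp f g (f ^ n) =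
          C (n * f.coeff 1 + 1 / 2 * (f.coeff 1 - g.coeff 0)) * f ^ n := by
        rw [skewOp, derivative_pow, hdf]
        have hgc : g = C (g.coeff 0) := by rw [hge]; simp
        conv_lhs => rw [hgc]
        rcases n with _ | n
        · simp
        · simp only [C_add, C_mul, C_sub, Nat.add_one_sub_one, Polynomial.C_eq_natCast]
          ring
      have h0 := hV.skewOp_ne_zero_of_end h (pow_ne_zero n hV.f_ne_zero) (hb _ hfn.le)
      refine hfin (f ^ n) hfn.le h0 ?_
      rw [hs] at h0 ⊢
      rw [natDegree_C_mul (fun hz => h0 (by rw [hz]; simp)), hfn]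
  · have hc : (skewOp f g (X ^ n)).coeff (n + 1) ≠ 0 := by
      rw [skewOp, hdf, hge, hfe]
      simp only [add_mul, mul_assoc, sub_mul, mul_sub, mul_add, coeff_add, coeff_sub, coeff_C_mul,
        coeff_X_mul, coeff_derivative_X_pow le_rfl, coeff_derivative_X_pow (Nat.le_succ n),
        coeff_X_pow_self, mul_zero, coeff_X_pow]
      simpa using hg1
    exact hfin (X ^ n) (by simp) (fun h0 => by simp [h0] at hc)
      ((Nat.le_succ n).trans (le_natDegree_of_ne_zero hc))

theorem integrableAtFilter_infinite (hV : IsPearsonWeight f g V I) {n : ℕ}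
    (hM : HasMoments I V n) (h : IsEnd I l σ) (he : l ≤ cocompact ℝ)
    {P : ℝ[X]} (hP : P.natDegree ≤ n) :
    IntegrableAtFilter (fun x => weightDiv f V x * P.eval x) l := by
  rcases Nat.lt_or_ge f.natDegree 2 with hf | hf
  · exact hV.integrableAtFilter_infinite_of_one hM h he (by omega) hP
  · exact hV.integrableAtFilter_infinite_of_two hM h he hf hP

end LocalAnalysis

/-- The weight `e^{-2V}` is not integrable if `f` and `f' - g` vanish to second and first order
at the same point `e`: it would be a power of `x - e`. -/
theorem false_of_double_root (hV : IsPearsonWeight f g V I) {n : ℕ} (hM : HasMoments I V n)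
    {e s t : ℝ} (hf : f = C s * (X - C e) ^ 2) (hq : derivative f - g = C t * (X - C e)) :
    False := by
  have hs : s ≠ 0 := fun h0 => hV.f_ne_zero (by rw [hf, h0]; simp)
  have hfx : ∀ x, f.eval x = s * (x - e) ^ 2 := fun x => by rw [hf]; simp
  have hgx : ∀ x, g.eval x = (2 * s - t) * (x - e) := fun x => by
    have h1 : g = derivative f - C t * (X - C e) := by rw [← hq]; ring
    rw [h1, hf]
    simp [derivative_pow]
    ring
  have hne : ∀ x ∈ I, x - e ≠ 0 := fun x hx h0 => by
    have := hV.f_pos x hx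
    rw [hfx, h0] at this
    simp at this
  have hd : ∀ x ∈ I, HasDerivAt (fun x => (x - e) * Real.exp (-2 * V x))
      ((t / s - 1) * Real.exp (-2 * V x)) x := by
    intro x hx
    have := ((hasDerivAt_id x).sub_const e).mul (hV.hasDerivAt_exp hx)
    refine this.congr_deriv ?_
    rw [hfx, hgx]
    have := hne x hx
    simp only [id]
    field_simp
    ring
  have hlim : ∀ {l : Filter ℝ} {σ : ℝ}, IsEnd I l σ →
      Tendsto (fun x => (x - e) * Real.exp (-2 * V x)) l (𝓝 0) := by
    intro l σ h
    have hle : l ≤ 𝓝[≠] e ∨ l ≤ cocompact ℝ := by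
      refine (h.kind hV.isOpen).imp_left ?_
      rintro ⟨e', hef, hle, -⟩
      have := hV.f_frontier e' hef
      rw [hfx] at this
      have h0 : e' - e = 0 := by simpa [hs] using this
      rwa [sub_eq_zero.1 h0] at hle
    refine h.tendsto_zero hV.ordConnected hd ?_ fun δ hδ =>
      h.not_eventually_le_abs hV.ordConnected hle hM.1 ?_ hδ
    · rcases le_total 0 (t / s - 1) with hc | hc
      · exact Or.inl (Eventually.of_forall fun x => mul_nonneg hc (Real.exp_pos _).le)
      · exact Or.inr (Eventually.of_forall fun x =>
          mul_nonpos_of_nonpos_of_nonneg hc (Real.exp_pos _).le)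
    · refine (isBigO_refl (fun x => Real.exp (-2 * V x)) l).congr' ?_ EventuallyEq.rfl
      filter_upwards [h.mem] with x hx
      have := hne x hx
      field_simp
  have hl := isEnd_left hV.isOpen hV.ordConnected hV.nonempty
  have hr := isEnd_right hV.isOpen hV.ordConnected hV.nonempty
  obtain ⟨y, hy⟩ := hV.nonempty
  have hint : IntegrableOn (fun x => (t / s - 1) * Real.exp (-2 * V x)) I := hM.1.const_mul _
  have e1 := setIntegral_deriv_Ioi hV.isOpen hV.ordConnected hr hd hint (hlim hr) hy
  have e2 := setIntegral_deriv_Iio hV.isOpen hV.ordConnected hl hd hint (hlim hl) hy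
  rw [integral_const_mul] at e1 e2
  have p1 : 0 ≤ ∫ x in I ∩ Ioi y, Real.exp (-2 * V x) :=
    integral_nonneg fun x => (Real.exp_pos _).le
  have p2 : 0 ≤ ∫ x in I ∩ Iic y, Real.exp (-2 * V x) :=
    integral_nonneg fun x => (Real.exp_pos _).le
  -- The integrals of the weight on the two sides of `y`, each times `t / s - 1`, are `∓ (y - e)
  -- e^{-2V(y)}`: of opposite signs and nonzero, although both integrals are nonnegative.
  have hM0 : (y - e) * Real.exp (-2 * V y) ≠ 0 := mul_ne_zero (hne y hy) (Real.exp_pos _).ne'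
  have h3 : (t / s - 1) ^ 2 * ((∫ x in I ∩ Ioi y, Real.exp (-2 * V x)) *
      ∫ x in I ∩ Iic y, Real.exp (-2 * V x)) = -((y - e) * Real.exp (-2 * V y)) ^ 2 := by
    calc _ = ((t / s - 1) * ∫ x in I ∩ Ioi y, Real.exp (-2 * V x)) *
          ((t / s - 1) * ∫ x in I ∩ Iic y, Real.exp (-2 * V x)) := by ring
      _ = _ := by rw [e1, e2]; ring
  have h4 : 0 < ((y - e) * Real.exp (-2 * V y)) ^ 2 := by positivity
  have h5 := mul_nonneg (sq_nonneg (t / s - 1)) (mul_nonneg p1 p2)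
  linarith

/-- If `f' - g` does not vanish at `e`, then `skewOp f g 1` is bounded away from zero there and `ψ =
1` dominates every polynomial. If it vanishes, the weight is not integrable, for a simple and for a
double zero of `f` alike. -/
theorem integrableAtFilter_finite (hV : IsPearsonWeight f g V I) {n : ℕ}
    (hM : HasMoments I V n) {l : Filter ℝ} {σ e : ℝ} (h : IsEnd I l σ) (he : l ≤ 𝓝[≠] e)
    (hσ : ∀ᶠ x in l, 0 < σ * (x - e)) (hfe : f.eval e = 0) (P : ℝ[X]) :
    IntegrableAtFilter (fun x => weightDiv f V x * P.eval x) l := by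
  have hb : ∀ ψ : ℝ[X],
      ∀ δ > 0, ¬ ∀ᶠ x in l, δ ≤ |(f * ψ ^ 2).eval x * Real.exp (-2 * V x)| :=
    fun ψ δ hδ => hV.not_eventually_le_abs_finite hM h he hfe (ψ ^ 2) hδ
  have hle : l ≤ 𝓝 e := he.trans nhdsWithin_le_nhds
  by_cases hqe : (derivative f - g).eval e = 0
  · exfalso
    have hqd : (derivative f - g).natDegree ≤ 1 := by
      refine (natDegree_sub_le _ _).trans (max_le ?_ hV.natDegree_g)
      exact (natDegree_derivative_le f).trans (by have := hV.natDegree_f; omega)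
    obtain ⟨k, hk⟩ := dvd_iff_isRoot.2 hfe
    obtain ⟨t, ht⟩ : ∃ t, derivative f - g = C t * (X - C e) := by
      refine ⟨(derivative f - g).coeff 1, ?_⟩
      have h1 := eq_X_add_C_of_natDegree_le_one hqd
      rw [h1] at hqe
      simp only [eval_add, eval_mul, eval_C, eval_X] at hqe
      conv_lhs => rw [h1]
      rw [eq_neg_of_add_eq_zero_right hqe]
      simp only [C_neg, C_mul]
      ring
    by_cases hke : k.eval e = 0
    · obtain ⟨j, hj⟩ := dvd_iff_isRoot.2 hke
      have hf0 := hV.f_ne_zero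
      have hj0 : j ≠ 0 := fun h0 => hf0 (by rw [hk, hj, h0]; simp)
      have hfj : f = (X - C e) ^ 2 * j := by rw [hk, hj]; ring
      have hdeg : j.natDegree = 0 := by
        have := hV.natDegree_f
        rw [hfj, natDegree_mul (pow_ne_zero _ (X_sub_C_ne_zero e)) hj0, natDegree_pow,
          natDegree_X_sub_C] at this
        omega
      obtain ⟨s, hs⟩ := natDegree_eq_zero.1 hdeg
      exact hV.false_of_double_root hM (s := s) (by rw [hfj, ← hs]; ring) ht
    -- With this slope, `ψ * skewOp f g ψ` is `x - e` times a polynomial equal to `-1` at `e`, which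
    -- is the sign excluded by `not_eventually_skewOp_nonpos`.
    · set a := -(1 + t / 2) / k.eval e with ha
      set ψ : ℝ[X] := 1 + C a * (X - C e) with hψ
      have hψe : ψ.eval e = 1 := by simp [hψ]
      have hψ0 : ψ ≠ 0 := fun h0 => by simp [h0] at hψe
      have hs : ψ * skewOp f g ψ = (X - C e) * (ψ * (k * C a + C (1 / 2) * C t * ψ)) := by
        have hdψ : derivative ψ = C a := by rw [hψ]; simp
        rw [skewOp, ht, hdψ, hk]; ring
      refine hV.not_eventually_skewOp_nonpos h hψ0 (hb ψ) ?_
      have hval : (ψ * (k * C a + C (1 / 2) * C t * ψ)).eval e < 0 := by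
        simp only [eval_mul, eval_add, eval_C, hψe, ha]
        field_simp
        norm_num
      have hev : ∀ᶠ x in l, (ψ * (k * C a + C (1 / 2) * C t * ψ)).eval x < 0 :=
        hle (((ψ * (k * C a + C (1 / 2) * C t * ψ)).continuous.tendsto e).eventually
          (gt_mem_nhds hval))
      filter_upwards [hσ, hev] with x hx hx2
      rw [hs, eval_mul, ← mul_assoc]
      simp only [eval_sub, eval_X, eval_C]
      exact (mul_neg_of_pos_of_neg hx hx2).le
  · refine hV.integrableAtFilter_of_isBigO h (hb 1) ?_
    have h1 : (fun x => P.eval x) =O[l] fun _ => (1 : ℝ) :=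
      ((P.continuous.tendsto e).mono_left hle).isBigO_one ℝ
    refine h1.trans ?_
    have hs : (skewOp f g 1).eval e ≠ 0 := by
      simpa [skewOp] using hqe
    have h2 : Tendsto (fun x => (skewOp f g 1).eval x) l (𝓝 ((skewOp f g 1).eval e)) :=
      ((skewOp f g 1).continuous.tendsto e).mono_left hle
    refine IsBigO.of_bound (2 / |(skewOp f g 1).eval e|) ?_
    have hpos : 0 < |(skewOp f g 1).eval e| := abs_pos.2 hs
    have h3 := h2.abs.eventually (lt_mem_nhds (half_lt_self hpos))
    filter_upwards [h3] with x hx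
    rw [norm_one, Real.norm_eq_abs, div_mul_eq_mul_div, le_div_iff₀ hpos]
    linarith

theorem integrableAtFilter_end (hV : IsPearsonWeight f g V I) {n : ℕ}
    (hM : HasMoments I V n) {l : Filter ℝ} {σ : ℝ} (h : IsEnd I l σ)
    {P : ℝ[X]} (hP : P.natDegree ≤ n) :
    IntegrableAtFilter (fun x => weightDiv f V x * P.eval x) l := by
  rcases h.kind hV.isOpen with ⟨e, hef, he, hσ⟩ | he
  · exact hV.integrableAtFilter_finite hM h he hσ (hV.f_frontier e hef) P
  · exact hV.integrableAtFilter_infinite hM h he hP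

theorem integrableOn_weightDiv_mul (hV : IsPearsonWeight f g V I) {n : ℕ}
    (hM : HasMoments I V n) {P : ℝ[X]} (hP : P.natDegree ≤ n) :
    IntegrableOn (fun x => weightDiv f V x * P.eval x) I := by
  have hl := isEnd_left hV.isOpen hV.ordConnected hV.nonempty
  have hr := isEnd_right hV.isOpen hV.ordConnected hV.nonempty
  exact integrableOn_of_ends hV.ordConnected hl hr
    (hV.continuousOn_weightDiv.mul P.continuous.continuousOn)
    (hV.integrableAtFilter_end hM hl hP) (hV.integrableAtFilter_end hM hr hP)

end IsPearsonWeight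

/-! ### Moments, integration by parts and the skew inner products -/

/-- The integral of a polynomial against the weight `e^{-2V}`. -/
noncomputable def moment (I : Set ℝ) (V : ℝ → ℝ) (P : ℝ[X]) : ℝ :=
  ∫ x in I, P.eval x * Real.exp (-2 * V x)

theorem inner₂_eq_moment (I : Set ℝ) (V : ℝ → ℝ) (φ ψ : ℝ[X]) :
    inner₂ I V φ ψ = moment I V (φ * ψ) := by
  simp only [inner₂, moment, eval_mul]

theorem moment_C_mul (I : Set ℝ) (V : ℝ → ℝ) (c : ℝ) (P : ℝ[X]) :
    moment I V (C c * P) = c * moment I V P := by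
  simp only [moment, eval_mul, eval_C, mul_assoc]
  exact integral_const_mul c _

theorem moment_neg (I : Set ℝ) (V : ℝ → ℝ) (P : ℝ[X]) : moment I V (-P) = -moment I V P := by
  have := moment_C_mul I V (-1) P
  rwa [C_neg, C_1, neg_one_mul, neg_one_mul] at this

@[simp] theorem moment_zero (I : Set ℝ) (V : ℝ → ℝ) : moment I V 0 = 0 := by
  simp [moment]

theorem measurable_sign : Measurable Real.sign := by
  unfold Real.sign
  exact Measurable.ite measurableSet_Iio measurable_const
    (Measurable.ite measurableSet_Ioi measurable_const measurable_const)

theorem abs_sign_le_one (x : ℝ) : |Real.sign x| ≤ 1 := by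
  rcases Real.sign_apply_eq x with h | h | h <;> simp [h]

theorem natDegree_mul_derivative_le {f : ℝ[X]} (hf : f.natDegree ≤ 2) (φ : ℝ[X]) :
    (f * derivative φ).natDegree ≤ φ.natDegree + 1 := by
  by_cases h : φ.natDegree = 0
  · rw [derivative_of_natDegree_zero h]; simp
  · have h1 := natDegree_derivative_lt h
    have h2 := natDegree_mul_le (p := f) (q := derivative φ)
    omega

theorem integrand₁_eq (f : ℝ[X]) (V : ℝ → ℝ) (φ ψ : ℝ[X]) (s : ℝ × ℝ) :
    integrand₁ (V₁ f V) φ ψ s = Real.sign (s.2 - s.1) *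
      ((weightDiv f V s.1 * φ.eval s.1) * (weightDiv f V s.2 * ψ.eval s.2)) := by
  rw [integrand₁, sub_eq_add_neg (-V₁ f V s.1), Real.exp_add, weightDiv, weightDiv]
  ring

namespace IsPearsonWeight

variable {f g : ℝ[X]} {V : ℝ → ℝ} {I : Set ℝ} {n : ℕ}

theorem natDegree_drift_le (hV : IsPearsonWeight f g V I) :
    (derivative f - g).natDegree ≤ 1 := by
  refine (natDegree_sub_le _ _).trans (max_le ?_ hV.natDegree_g)
  exact (natDegree_derivative_le f).trans (by have := hV.natDegree_f; omega)

theorem natDegree_pearson_le (hV : IsPearsonWeight f g V I) (φ : ℝ[X]) :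
    (f * derivative φ + (derivative f - g) * φ).natDegree ≤ φ.natDegree + 1 := by
  refine natDegree_add_le_of_degree_le (natDegree_mul_derivative_le hV.natDegree_f φ) ?_
  have h1 := natDegree_mul_le (p := derivative f - g) (q := φ)
  have h2 := hV.natDegree_drift_le
  omega

theorem natDegree_skewOp_le (hV : IsPearsonWeight f g V I) (φ : ℝ[X]) :
    (skewOp f g φ).natDegree ≤ φ.natDegree + 1 := by
  refine natDegree_add_le_of_degree_le (natDegree_mul_derivative_le hV.natDegree_f φ) ?_
  have h1 := natDegree_mul_le (p := C (1 / 2) * (derivative f - g)) (q := φ)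
  have h2 := hV.natDegree_drift_le
  have h3 := natDegree_C_mul_le (1 / 2 : ℝ) (derivative f - g)
  omega

theorem moment_add (hV : IsPearsonWeight f g V I) (hM : HasMoments I V n) {P Q : ℝ[X]}
    (hP : P.natDegree ≤ 2 * n) (hQ : Q.natDegree ≤ 2 * n) :
    moment I V (P + Q) = moment I V P + moment I V Q := by
  simp only [moment, eval_add, add_mul]
  exact integral_add (hV.integrableOn_eval_mul hM hP) (hV.integrableOn_eval_mul hM hQ)

theorem moment_sub (hV : IsPearsonWeight f g V I) (hM : HasMoments I V n) {P Q : ℝ[X]}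
    (hP : P.natDegree ≤ 2 * n) (hQ : Q.natDegree ≤ 2 * n) :
    moment I V (P - Q) = moment I V P - moment I V Q := by
  rw [sub_eq_add_neg, hV.moment_add hM hP (by rwa [natDegree_neg]), moment_neg, ← sub_eq_add_neg]

theorem moment_pos (hV : IsPearsonWeight f g V I) (hM : HasMoments I V n) {P : ℝ[X]}
    (hP : P.natDegree ≤ 2 * n) (h0 : P ≠ 0) (hnn : ∀ x ∈ I, 0 ≤ P.eval x) :
    0 < moment I V P := by
  rw [moment, setIntegral_pos_iff_support_of_nonneg_ae
    ((ae_restrict_iff' hV.measurableSet).2 (ae_of_all _ fun x hx =>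
      mul_nonneg (hnn x hx) (Real.exp_pos _).le)) (hV.integrableOn_eval_mul hM hP)]
  have hfin : {x | P.eval x = 0}.Finite := by
    refine (P.roots.toFinset.finite_toSet).subset fun x hx => ?_
    simpa [h0] using hx
  have hI : 0 < volume I := hV.isOpen.measure_pos volume hV.nonempty
  refine lt_of_lt_of_le hI ?_
  calc volume I = volume (I \ {x | P.eval x = 0}) :=
        (measure_sdiff_null (hfin.measure_zero volume)).symm
    _ ≤ _ := measure_mono fun x (hx : x ∈ I \ {x | P.eval x = 0}) =>
        mem_inter (mul_ne_zero hx.2 (Real.exp_pos _).ne') hx.1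

/-- Integration by parts against the Pearson weight. -/
theorem moment_pearson (hV : IsPearsonWeight f g V I) (hM : HasMoments I V n) {φ : ℝ[X]}
    (hφ : φ.natDegree + 1 ≤ 2 * n) :
    moment I V (f * derivative φ + (derivative f - g) * φ) = 0 := by
  have hl := isEnd_left hV.isOpen hV.ordConnected hV.nonempty
  have hr := isEnd_right hV.isOpen hV.ordConnected hV.nonempty
  have hdeg : (f * φ).natDegree ≤ 2 * n + 1 := by
    have h1 := natDegree_mul_le (p := f) (q := φ)
    have h2 := hV.natDegree_f
    omega
  have hint := hV.integrableOn_eval_mul hM ((hV.natDegree_pearson_le φ).trans hφ)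
  obtain ⟨y, hy⟩ := hV.nonempty
  have e1 := setIntegral_deriv_Ioi hV.isOpen hV.ordConnected hr
    (fun x hx => hV.hasDerivAt_mul_exp φ hx) hint (hV.tendsto_mul_exp hM hr hdeg) hy
  have e2 := setIntegral_deriv_Iio hV.isOpen hV.ordConnected hl
    (fun x hx => hV.hasDerivAt_mul_exp φ hx) hint (hV.tendsto_mul_exp hM hl hdeg) hy
  have h := integral_inter_add_sdiff (s := I) (measurableSet_Ioi (a := y)) hint
  rw [sdiff_eq, compl_Ioi, e1, e2] at h
  rw [moment, ← h]
  ring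

/-- `skewOp f g` is antisymmetric with respect to the weight. -/
theorem moment_skewOp_mul (hV : IsPearsonWeight f g V I) (hM : HasMoments I V n) {φ ψ : ℝ[X]}
    (hd : φ.natDegree + ψ.natDegree + 1 ≤ 2 * n) :
    moment I V (skewOp f g φ * ψ) = -moment I V (φ * skewOp f g ψ) := by
  have hm := natDegree_mul_le (p := φ) (q := ψ)
  have h := hV.moment_pearson hM (φ := φ * ψ) (by omega)
  have he : f * derivative (φ * ψ) + (derivative f - g) * (φ * ψ) =
      skewOp f g φ * ψ + φ * skewOp f g ψ := by
    have hC : (C (1 / 2) : ℝ[X]) + C (1 / 2) = 1 := by rw [← C_add]; norm_num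
    rw [skewOp, skewOp, derivative_mul]
    linear_combination (-(derivative f - g) * φ * ψ) * hC
  rw [he, hV.moment_add hM] at h
  · linarith
  · have h1 := natDegree_mul_le (p := skewOp f g φ) (q := ψ)
    have h2 := hV.natDegree_skewOp_le φ
    omega
  · have h1 := natDegree_mul_le (p := φ) (q := skewOp f g ψ)
    have h2 := hV.natDegree_skewOp_le ψ
    omega

theorem integrableOn_integrand₁ (hV : IsPearsonWeight f g V I) (hM : HasMoments I V n)
    {φ ψ : ℝ[X]} (hφ : φ.natDegree ≤ n) (hψ : ψ.natDegree ≤ n) :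
    IntegrableOn (integrand₁ (V₁ f V) φ ψ) (I ×ˢ I) := by
  have h1 := (hV.integrableOn_weightDiv_mul hM hφ).mul_prod (hV.integrableOn_weightDiv_mul hM hψ)
  rw [Measure.prod_restrict, ← Measure.volume_eq_prod] at h1
  have h2 := h1.bdd_mul (c := 1) (f := fun s : ℝ × ℝ => Real.sign (s.2 - s.1))
    (measurable_sign.comp (measurable_snd.sub measurable_fst)).aestronglyMeasurable
    (ae_of_all _ fun s => abs_sign_le_one _)
  exact h2.congr (ae_of_all _ fun s => (integrand₁_eq f V φ ψ s).symm)

theorem inner₁_add_right (hV : IsPearsonWeight f g V I) (hM : HasMoments I V n)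
    {φ ψ χ : ℝ[X]} (hφ : φ.natDegree ≤ n) (hψ : ψ.natDegree ≤ n) (hχ : χ.natDegree ≤ n) :
    inner₁ I (V₁ f V) φ (ψ + χ) = inner₁ I (V₁ f V) φ ψ + inner₁ I (V₁ f V) φ χ := by
  rw [inner₁, inner₁, inner₁, ← mul_add, ← integral_add
    (hV.integrableOn_integrand₁ hM hφ hψ) (hV.integrableOn_integrand₁ hM hφ hχ)]
  congr 2
  ext s
  simp only [integrand₁, eval_add]
  ring

theorem inner₁_C_mul_right (I : Set ℝ) (W : ℝ → ℝ) (c : ℝ) (φ ψ : ℝ[X]) :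
    inner₁ I W φ (C c * ψ) = c * inner₁ I W φ ψ := by
  rw [inner₁, inner₁, mul_left_comm, ← integral_const_mul c]
  congr 2
  ext s
  simp only [integrand₁, eval_mul, eval_C]
  ring

theorem inner₁_swap (I : Set ℝ) (W : ℝ → ℝ) (φ ψ : ℝ[X]) :
    inner₁ I W ψ φ = -inner₁ I W φ ψ := by
  rw [inner₁, inner₁, ← mul_neg, ← integral_neg, Measure.volume_eq_prod,
    ← setIntegral_prod_swap]
  congr 1
  refine integral_congr_ae (ae_of_all _ fun s => ?_)
  simp only [integrand₁, Prod.fst_swap, Prod.snd_swap]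
  rw [← neg_sub s.1 s.2, Real.sign_neg, show -W s.1 - W s.2 = -W s.2 - W s.1 by ring]
  ring

/-- The integrand is `±` the derivative of `e^{-V₂} ψ`, which vanishes at both ends. Each side of
`y` contributes `-e^{-V₂(y)} ψ(y)`. -/
theorem setIntegral_sign_mul (hV : IsPearsonWeight f g V I) (hM : HasMoments I V n) {ψ : ℝ[X]}
    (hψ : ψ.natDegree + 1 ≤ n) {y : ℝ} (hy : y ∈ I) :
    ∫ z in I, Real.sign (z - y) * (weightDiv f V z * (skewOp f g ψ).eval z) =
      -2 * (weightMul f V y * ψ.eval y) := by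
  have hl := isEnd_left hV.isOpen hV.ordConnected hV.nonempty
  have hr := isEnd_right hV.isOpen hV.ordConnected hV.nonempty
  have hdeg : (f * ψ ^ 2).natDegree ≤ 2 * n + 1 := by
    have h1 := natDegree_mul_le (p := f) (q := ψ ^ 2)
    have h2 := hV.natDegree_f
    have h3 : (ψ ^ 2).natDegree ≤ 2 * ψ.natDegree := natDegree_pow_le
    omega
  have hint := hV.integrableOn_weightDiv_mul hM ((hV.natDegree_skewOp_le ψ).trans hψ)
  have hlim : ∀ {l : Filter ℝ} {σ : ℝ}, IsEnd I l σ →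
      Tendsto (fun x => weightMul f V x * ψ.eval x) l (𝓝 0) := fun h =>
    hV.tendsto_weightMul h fun δ hδ => hV.not_eventually_le_abs hM h hdeg hδ
  have e1 := setIntegral_deriv_Ioi hV.isOpen hV.ordConnected hr
    (fun x hx => hV.hasDerivAt_weightMul_mul ψ hx) hint (hlim hr) hy
  have e2 := setIntegral_deriv_Iio hV.isOpen hV.ordConnected hl
    (fun x hx => hV.hasDerivAt_weightMul_mul ψ hx) hint (hlim hl) hy
  have hint2 : IntegrableOn
      (fun z => Real.sign (z - y) * (weightDiv f V z * (skewOp f g ψ).eval z)) I :=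
    hint.bdd_mul (c := 1) (measurable_sign.comp (measurable_id.sub_const y)).aestronglyMeasurable
      (ae_of_all _ fun s => abs_sign_le_one _)
  rw [← integral_inter_add_sdiff (s := I) (measurableSet_Ioi (a := y)) hint2, sdiff_eq, compl_Ioi]
  have e3 : ∫ z in I ∩ Ioi y, Real.sign (z - y) * (weightDiv f V z * (skewOp f g ψ).eval z) =
      ∫ z in I ∩ Ioi y, weightDiv f V z * (skewOp f g ψ).eval z :=
    setIntegral_congr_fun (hV.measurableSet.inter measurableSet_Ioi) fun z hz => by
      rw [Real.sign_of_pos (sub_pos.2 hz.2), one_mul]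
  have e4 : ∫ z in I ∩ Iic y, Real.sign (z - y) * (weightDiv f V z * (skewOp f g ψ).eval z) =
      ∫ z in I ∩ Iic y, -(weightDiv f V z * (skewOp f g ψ).eval z) := by
    refine setIntegral_congr_ae (hV.measurableSet.inter measurableSet_Iic) ?_
    filter_upwards [measure_eq_zero_iff_ae_notMem.1 (measure_singleton (μ := volume) y)] with z hz hz2
    rw [Real.sign_of_neg (sub_neg.2 (lt_of_le_of_ne hz2.2 hz)), neg_one_mul]
  rw [e3, e4, integral_neg, e1, e2]
  ring

/-- `skewOp f g` inverts the kernel of the `β = 1` skew inner product. -/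
theorem inner₁_skewOp (hV : IsPearsonWeight f g V I) (hM : HasMoments I V n) {φ ψ : ℝ[X]}
    (hφ : φ.natDegree ≤ n) (hψ : ψ.natDegree + 1 ≤ n) :
    inner₁ I (V₁ f V) φ (skewOp f g ψ) = -moment I V (φ * ψ) := by
  have hint := hV.integrableOn_integrand₁ hM hφ ((hV.natDegree_skewOp_le ψ).trans hψ)
  rw [inner₁, Measure.volume_eq_prod, setIntegral_prod _ hint, moment, ← integral_neg,
    ← integral_const_mul]
  refine setIntegral_congr_fun hV.measurableSet fun y hy => ?_
  have e : ∀ z, integrand₁ (V₁ f V) φ (skewOp f g ψ) (y, z) = (weightDiv f V y * φ.eval y) *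
      (Real.sign (z - y) * (weightDiv f V z * (skewOp f g ψ).eval z)) := fun z => by
    rw [integrand₁_eq]; ring
  simp only [e]
  rw [integral_const_mul, hV.setIntegral_sign_mul hM hψ hy, ← weightDiv_mul_weightMul f V y,
    eval_mul]
  ring

theorem integrand₄_eq (hV : IsPearsonWeight f g V I) (φ ψ : ℝ[X]) {x : ℝ} (hx : x ∈ I) :
    integrand₄ (V₂ f V) φ ψ x =
      (φ * (f * derivative ψ) - f * derivative φ * ψ).eval x * Real.exp (-2 * V x) := by
  rw [integrand₄, hV.exp_V₂_eq hx]
  simp only [eval_sub, eval_mul]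
  ring

theorem natDegree_wronskian_le (hV : IsPearsonWeight f g V I) (φ ψ : ℝ[X]) :
    (φ * (f * derivative ψ)).natDegree ≤ φ.natDegree + ψ.natDegree + 1 ∧
      (f * derivative φ * ψ).natDegree ≤ φ.natDegree + ψ.natDegree + 1 := by
  have h1 := natDegree_mul_le (p := φ) (q := f * derivative ψ)
  have h2 := natDegree_mul_derivative_le hV.natDegree_f ψ
  have h3 := natDegree_mul_le (p := f * derivative φ) (q := ψ)
  have h4 := natDegree_mul_derivative_le hV.natDegree_f φ
  omega

theorem integrableOn_integrand₄ (hV : IsPearsonWeight f g V I) (hM : HasMoments I V n)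
    {φ ψ : ℝ[X]} (hd : φ.natDegree + ψ.natDegree + 1 ≤ 2 * n) :
    IntegrableOn (integrand₄ (V₂ f V) φ ψ) I := by
  obtain ⟨h1, h2⟩ := hV.natDegree_wronskian_le φ ψ
  refine (hV.integrableOn_eval_mul hM
    (P := φ * (f * derivative ψ) - f * derivative φ * ψ) ?_).congr_fun
    (fun x hx => (hV.integrand₄_eq φ ψ hx).symm) hV.measurableSet
  exact (natDegree_sub_le _ _).trans (max_le (h1.trans hd) (h2.trans hd))

theorem inner₄_eq (hV : IsPearsonWeight f g V I) (hM : HasMoments I V n)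
    {φ ψ : ℝ[X]} (hd : φ.natDegree + ψ.natDegree + 1 ≤ 2 * n) :
    inner₄ I (V₂ f V) φ ψ =
      1 / 2 * (moment I V (φ * (f * derivative ψ)) - moment I V (f * derivative φ * ψ)) := by
  obtain ⟨h1, h2⟩ := hV.natDegree_wronskian_le φ ψ
  rw [inner₄, ← hV.moment_sub hM (h1.trans hd) (h2.trans hd), moment]
  congr 1
  exact setIntegral_congr_fun hV.measurableSet fun x hx => hV.integrand₄_eq φ ψ hx

theorem inner₄_swap (I : Set ℝ) (W : ℝ → ℝ) (φ ψ : ℝ[X]) :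
    inner₄ I W ψ φ = -inner₄ I W φ ψ := by
  rw [inner₄, inner₄, ← mul_neg, ← integral_neg]
  congr 2
  ext s
  simp only [integrand₄]
  ring

end IsPearsonWeight

/-! ### Orthogonal polynomials with finitely or infinitely many moments -/

theorem natDegree_le_of_degree_lt_succ {φ : ℝ[X]} {m : ℕ} (h : φ.degree < ((m + 1 : ℕ) : WithBot ℕ)) :
    φ.natDegree ≤ m := by
  rw [natDegree_le_iff_coeff_eq_zero]
  exact fun k hk => (degree_lt_iff_coeff_zero _ _).1 h k hk

theorem degree_lt_succ_of_natDegree_le {φ : ℝ[X]} {m : ℕ} (h : φ.natDegree ≤ m) :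
    φ.degree < ((m + 1 : ℕ) : WithBot ℕ) :=
  (degree_lt_iff_coeff_zero _ _).2 fun k hk => coeff_eq_zero_of_natDegree_lt (by omega)

theorem degree_sub_C_mul_lt {φ q : ℝ[X]} {m : ℕ} (hφ : φ.natDegree ≤ m) (hq : q.Monic)
    (hqd : q.natDegree = m) : (φ - C (φ.coeff m) * q).degree < (m : WithBot ℕ) := by
  refine (degree_lt_iff_coeff_zero _ _).2 fun k hk => ?_
  rw [coeff_sub, coeff_C_mul]
  rcases hk.eq_or_lt with rfl | hk
  · have : q.coeff m = 1 := by rw [← hqd]; exact hq.coeff_natDegree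
    rw [this]; ring
  · rw [coeff_eq_zero_of_natDegree_lt (hφ.trans_lt hk),
      coeff_eq_zero_of_natDegree_lt (p := q) (by omega)]
    ring

namespace IsMonicOrthogonal

variable {f g : ℝ[X]} {V : ℝ → ℝ} {I : Set ℝ} {N : ℕ∞} {p : ℕ → ℝ[X]} {n : ℕ}

theorem hasMoments (hp : IsMonicOrthogonal I V N p) (hn : (n : ℕ∞) ≤ N) : HasMoments I V n := by
  refine ⟨?_, hp.squareIntegrable n hn⟩
  have := hp.squareIntegrable 0 (by simp)
  simpa using this

theorem le_of_le {N : ℕ∞} {m n : ℕ} (h : m ≤ n) (hn : (n : ℕ∞) ≤ N) : (m : ℕ∞) ≤ N :=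
  le_trans (by exact_mod_cast h) hn

theorem moment_eq_zero (hp : IsMonicOrthogonal I V N p) {m : ℕ} (hm : (m : ℕ∞) ≤ N)
    (hn : (n : ℕ∞) ≤ N) (h : m ≠ n) : moment I V (p m * p n) = 0 := by
  rw [← inner₂_eq_moment]; exact hp.orthogonal m n hm hn h

theorem moment_self_pos (hV : IsPearsonWeight f g V I) (hp : IsMonicOrthogonal I V N p)
    (hn : (n : ℕ∞) ≤ N) : 0 < moment I V (p n * p n) := by
  have h0 := (hp.monic n hn).ne_zero
  refine hV.moment_pos (hp.hasMoments hn) ?_ (mul_ne_zero h0 h0) fun x _ => ?_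
  · rw [natDegree_mul h0 h0, hp.natDegree n hn]; omega
  · rw [eval_mul]; exact mul_self_nonneg _

theorem natDegree_prev_le (hp : IsMonicOrthogonal I V N p) (hn : (n : ℕ∞) ≤ N) :
    (prev p n).natDegree ≤ n := by
  cases n with
  | zero => simp [prev]
  | succ k =>
    have hk := le_of_le (Nat.le_succ k) hn
    simp only [prev]
    rw [hp.natDegree k hk]; omega

theorem moment_prev_mul (hp : IsMonicOrthogonal I V N p) {k : ℕ} (hn : (n : ℕ∞) ≤ N)
    (hk : (k : ℕ∞) ≤ N) (hkn : k + 1 ≠ n) : moment I V (prev p n * p k) = 0 := by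
  cases n with
  | zero => simp [prev]
  | succ j =>
    exact hp.moment_eq_zero (le_of_le (Nat.le_succ j) hn) hk (by omega)

/-- Expand `φ` in the monic family, peeling off its top coefficient. The bound on degrees keeps
every product within the moments of order at most `2 n`, so that linearity may be used. -/
theorem moment_mul_eq_zero_of_orthogonal (hV : IsPearsonWeight f g V I)
    (hp : IsMonicOrthogonal I V N p) (hn : (n : ℕ∞) ≤ N) {q : ℝ[X]} {m : ℕ} (hm : m ≤ n + 1)
    (hd : q.natDegree + m ≤ 2 * n + 1) (h : ∀ k < m, moment I V (q * p k) = 0) {φ : ℝ[X]}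
    (hφ : φ.degree < (m : WithBot ℕ)) : moment I V (q * φ) = 0 := by
  induction m generalizing φ with
  | zero =>
    have : φ = 0 := by
      rw [← degree_eq_bot]
      simpa using hφ
    simp [this]
  | succ m ih =>
    have hm' := le_of_le (show m ≤ n by omega) hn
    have hdφ := natDegree_le_of_degree_lt_succ hφ
    have hlt := degree_sub_C_mul_lt hdφ (hp.monic m hm') (hp.natDegree m hm')
    have h1 := ih (by omega) (by omega) (fun k hk => h k (by omega)) hlt
    have h2 := natDegree_mul_le (p := q) (q := φ)
    have h3 := natDegree_mul_le (p := q) (q := p m)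
    rw [hp.natDegree m hm'] at h3
    have h4 := natDegree_C_mul_le (φ.coeff m) (q * p m)
    have e : q * (φ - C (φ.coeff m) * p m) = q * φ - C (φ.coeff m) * (q * p m) := by ring
    rw [e, hV.moment_sub (hp.hasMoments hn) (by omega) (by omega), moment_C_mul,
      h m (by omega)] at h1
    linarith

theorem moment_mul_eq_zero (hV : IsPearsonWeight f g V I)
    (hp : IsMonicOrthogonal I V N p) (hn : (n : ℕ∞) ≤ N) {φ : ℝ[X]}
    (hφ : φ.degree < (n : WithBot ℕ)) : moment I V (p n * φ) = 0 :=
  moment_mul_eq_zero_of_orthogonal hV hp hn (Nat.le_succ n)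
    (by rw [hp.natDegree n hn]; omega)
    (fun k hk => hp.moment_eq_zero hn (le_of_le hk.le hn) hk.ne') hφ

theorem eq_zero_of_orthogonal (hV : IsPearsonWeight f g V I)
    (hp : IsMonicOrthogonal I V N p) (hn : (n : ℕ∞) ≤ N) {q : ℝ[X]} (hq : q.natDegree ≤ n)
    (h : ∀ k ≤ n, moment I V (q * p k) = 0) : q = 0 := by
  by_contra h0
  have h1 : moment I V (q * q) = 0 :=
    moment_mul_eq_zero_of_orthogonal hV hp hn le_rfl (by omega)
      (fun k hk => h k (by omega)) (degree_lt_succ_of_natDegree_le hq)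
  have h2 := hV.moment_pos (hp.hasMoments hn) (P := q * q)
    (by rw [natDegree_mul h0 h0]; omega) (mul_ne_zero h0 h0)
    fun x _ => by rw [eval_mul]; exact mul_self_nonneg _
  exact h2.ne' h1

/-- A polynomial of degree at most `n` orthogonal to `p_k`, `k < n - 1`, is a combination of `p_n`
and `p_{n-1}`. -/
theorem eq_add_of_orthogonal (hV : IsPearsonWeight f g V I)
    (hp : IsMonicOrthogonal I V N p) (hn : (n : ℕ∞) ≤ N) {q : ℝ[X]}
    (hq : q.degree < ((n + 1 : ℕ) : WithBot ℕ)) (h : ∀ k, k + 1 < n → moment I V (q * p k) = 0) :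
    q = C (moment I V (q * p n) / moment I V (p n * p n)) * p n +
      C (moment I V (q * prev p n) / moment I V (prev p n * prev p n)) * prev p n := by
  have hM := hp.hasMoments hn
  have hqd := natDegree_le_of_degree_lt_succ hq
  have hpn := hp.natDegree n hn
  have hprev := hp.natDegree_prev_le hn
  set b := moment I V (q * p n) / moment I V (p n * p n) with hb
  -- For `n = 0` this is `0 / 0 = 0`, harmless since `prev p 0 = 0`.
  set c := moment I V (q * prev p n) / moment I V (prev p n * prev p n) with hc
  have hbn := natDegree_C_mul_le b (p n)
  have hcn := natDegree_C_mul_le c (prev p n)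
  rw [← sub_eq_zero, ← sub_sub]
  have hd1 : (q - C b * p n).natDegree ≤ n :=
    (natDegree_sub_le _ _).trans (max_le hqd (by omega))
  refine eq_zero_of_orthogonal hV hp hn
    ((natDegree_sub_le _ _).trans (max_le hd1 (by omega))) fun k hk => ?_
  have hkN := le_of_le hk hn
  have hpk := hp.natDegree k hkN
  have e : (q - C b * p n - C c * prev p n) * p k =
      q * p k - C b * (p n * p k) - C c * (prev p n * p k) := by ring
  have d1 := natDegree_mul_le (p := q) (q := p k)
  have d2 := natDegree_C_mul_le b (p n * p k)
  have d3 := natDegree_C_mul_le c (prev p n * p k)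
  have d4 := natDegree_mul_le (p := p n) (q := p k)
  have d5 := natDegree_mul_le (p := prev p n) (q := p k)
  rw [e, hV.moment_sub hM ((natDegree_sub_le _ _).trans (max_le (by omega) (by omega))) (by omega),
    hV.moment_sub hM (by omega) (by omega), moment_C_mul, moment_C_mul]
  rcases hk.eq_or_lt with rfl | hk
  · rw [hp.moment_prev_mul hn hn (by omega), hb,
      div_mul_cancel₀ _ (moment_self_pos hV hp hn).ne']
    ring
  rw [hp.moment_eq_zero hn hkN hk.ne']
  by_cases hk1 : k + 1 = n
  · subst hk1
    simp only [prev] at hc ⊢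
    rw [hc, div_mul_cancel₀ _ (moment_self_pos hV hp hkN).ne']
    ring
  · rw [hp.moment_prev_mul hn hkN hk1, h k (by omega)]
    ring

theorem moment_X_mul (hV : IsPearsonWeight f g V I) (hp : IsMonicOrthogonal I V N p)
    (hn : ((n + 1 : ℕ) : ℕ∞) ≤ N) :
    moment I V (p n * (X * p (n + 1))) = moment I V (p (n + 1) * p (n + 1)) := by
  have hn' := le_of_le (Nat.le_succ n) hn
  have hX : (X * p n).Monic := monic_X.mul (hp.monic n hn')
  have hXd : (X * p n).natDegree = n + 1 := by
    rw [natDegree_X_mul (hp.monic n hn').ne_zero, hp.natDegree n hn']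
  have hc : (X * p n).coeff (n + 1) = 1 := by rw [← hXd]; exact hX.coeff_natDegree
  have h := degree_sub_C_mul_lt hXd.le (hp.monic _ hn) (hp.natDegree _ hn)
  rw [hc, C_1, one_mul] at h
  have h0 := moment_mul_eq_zero hV hp hn h
  have hd := hp.natDegree _ hn
  have d1 := natDegree_mul_le (p := p (n + 1)) (q := X * p n)
  have d2 := natDegree_mul_le (p := p (n + 1)) (q := p (n + 1))
  rw [mul_sub, hV.moment_sub (hp.hasMoments hn) (by omega) (by omega)] at h0
  rw [show p n * (X * p (n + 1)) = p (n + 1) * (X * p n) by ring]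
  linarith

/-- Three term recurrence. -/
theorem exists_recurrence (hV : IsPearsonWeight f g V I) (hp : IsMonicOrthogonal I V N p)
    (hn : ((n + 1 : ℕ) : ℕ∞) ≤ N) :
    ∃ b c : ℝ, (n ≠ 0 → 0 < c) ∧ p (n + 1) = (X - C b) * p n - C c * prev p n := by
  have hn' := le_of_le (Nat.le_succ n) hn
  have hM := hp.hasMoments hn
  have hX : (X * p n).Monic := monic_X.mul (hp.monic n hn')
  have hXd : (X * p n).natDegree = n + 1 := by
    rw [natDegree_X_mul (hp.monic n hn').ne_zero, hp.natDegree n hn']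
  have hc : (X * p n).coeff (n + 1) = 1 := by rw [← hXd]; exact hX.coeff_natDegree
  have h := degree_sub_C_mul_lt hXd.le (hp.monic _ hn) (hp.natDegree _ hn)
  rw [hc, C_1, one_mul] at h
  have hmom : ∀ k, k < n → moment I V ((X * p n - p (n + 1)) * p k) =
      moment I V (p n * (X * p k)) := by
    intro k hk
    have hkN := le_of_le hk.le hn'
    have hdk := hp.natDegree k hkN
    have hd := hp.natDegree _ hn
    have d1 := natDegree_mul_le (p := X * p n) (q := p k)
    have d2 := natDegree_mul_le (p := p (n + 1)) (q := p k)
    rw [sub_mul, hV.moment_sub hM (by omega) (by omega), hp.moment_eq_zero hn hkN (by omega),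
      sub_zero]
    congr 1; ring
  have key := eq_add_of_orthogonal hV hp hn' h fun k hk => by
    rw [hmom k (by omega)]
    refine moment_mul_eq_zero hV hp hn' ?_
    have hkN := le_of_le (show k ≤ n by omega) hn'
    refine (degree_lt_iff_coeff_zero _ _).2 fun i hi => coeff_eq_zero_of_natDegree_lt ?_
    rw [natDegree_X_mul (hp.monic k hkN).ne_zero, hp.natDegree k hkN]
    omega
  refine ⟨moment I V ((X * p n - p (n + 1)) * p n) / moment I V (p n * p n),
    moment I V ((X * p n - p (n + 1)) * prev p n) / moment I V (prev p n * prev p n),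
    fun hn0 => ?_, by linear_combination -key⟩
  cases n with
  | zero => exact absurd rfl hn0
  | succ j =>
    have hj := le_of_le (Nat.le_succ j) hn'
    simp only [prev]
    have h1 : moment I V ((X * p (j + 1) - p (j + 1 + 1)) * p j) =
        moment I V (p (j + 1) * p (j + 1)) := by
      rw [hmom j (by omega), ← moment_X_mul hV hp hn']
      congr 1
      ring
    rw [h1]
    exact div_pos (moment_self_pos hV hp hn') (moment_self_pos hV hp hj)

/-- Positivity of the Wronskian of consecutive orthogonal polynomials. -/
theorem wronskian_pos (hV : IsPearsonWeight f g V I) (hp : IsMonicOrthogonal I V N p)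
    (hn : ((n + 1 : ℕ) : ℕ∞) ≤ N) (x : ℝ) :
    0 < (p n * derivative (p (n + 1)) - derivative (p n) * p (n + 1)).eval x := by
  induction n with
  | zero =>
    have h0 : p 0 = 1 :=
      (hp.monic 0 (by simp)).natDegree_eq_zero.1 (hp.natDegree 0 (by simp))
    obtain ⟨b, c, -, h1⟩ := exists_recurrence hV hp hn
    rw [h1, h0]
    simp [prev]
  | succ k ih =>
    have hk := le_of_le (Nat.le_succ _) hn
    obtain ⟨b, c, hc, h1⟩ := exists_recurrence hV hp hn
    simp only [prev] at h1
    have hih := ih hk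
    -- By the recurrence each Wronskian is a square plus the positive number `c` times the preceding
    -- one (the confluent Christoffel–Darboux formula in recursive form).
    have e : p (k + 1) * derivative (p (k + 1 + 1)) - derivative (p (k + 1)) * p (k + 1 + 1) =
        p (k + 1) * p (k + 1) +
          C c * (p k * derivative (p (k + 1)) - derivative (p k) * p (k + 1)) := by
      rw [h1]
      simp only [derivative_sub, derivative_mul, derivative_X, derivative_C]
      ring
    rw [e]
    have hsq : 0 ≤ (p (k + 1) * p (k + 1)).eval x := by
      rw [eval_mul]; exact mul_self_nonneg _
    rw [eval_add, eval_mul (p := C c), eval_C]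
    have := mul_pos (hc (Nat.succ_ne_zero k)) hih
    linarith

end IsMonicOrthogonal

/-! ### The operators `f d/dx` and `skewOp` in the orthogonal basis -/

namespace IsMonicOrthogonal

variable {f g : ℝ[X]} {V : ℝ → ℝ} {I : Set ℝ} {N : ℕ∞} {p : ℕ → ℝ[X]} {n : ℕ}

/-- A monic polynomial of degree `n + 1` orthogonal to `p_k`, `k < n`. -/
theorem exists_next (hV : IsPearsonWeight f g V I) (hp : IsMonicOrthogonal I V N p)
    (hn : (n : ℕ∞) ≤ N) :
    ∃ q : ℝ[X], q.Monic ∧ q.natDegree = n + 1 ∧ (∀ k < n, moment I V (q * p k) = 0) ∧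
      (((n + 1 : ℕ) : ℕ∞) ≤ N → q = p (n + 1)) := by
  by_cases hN : ((n + 1 : ℕ) : ℕ∞) ≤ N
  · exact ⟨p (n + 1), hp.monic _ hN, hp.natDegree _ hN,
      fun k hk => hp.moment_eq_zero hN (le_of_le hk.le hn) (by omega), fun _ => rfl⟩
  have hM := hp.hasMoments hn
  -- Gram–Schmidt from `X ^ (n + 1)`. It stops before `p n`, because `q * p n` has degree `2 n + 1`
  -- and its integral need not converge.
  have main : ∀ m ≤ n, ∃ q : ℝ[X], q.Monic ∧ q.natDegree = n + 1 ∧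
      ∀ k < m, moment I V (q * p k) = 0 := by
    intro m
    induction m with
    | zero => exact fun _ => ⟨X ^ (n + 1), monic_X_pow _, natDegree_X_pow _, by simp⟩
    | succ m ih =>
      intro hm
      obtain ⟨q, hq, hqd, hqo⟩ := ih (by omega)
      have hmN := le_of_le (show m ≤ n by omega) hn
      have hdm := hp.natDegree m hmN
      set c := moment I V (q * p m) / moment I V (p m * p m) with hc
      have hcd := natDegree_C_mul_le c (p m)
      have hlt : (C c * p m).degree < q.degree := by
        rw [degree_eq_natDegree hq.ne_zero]
        exact lt_of_le_of_lt degree_le_natDegree (by exact_mod_cast (by omega))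
      refine ⟨q - C c * p m, hq.sub_of_left hlt, ?_, fun k hk => ?_⟩
      · rw [natDegree_sub_eq_left_of_natDegree_lt (by omega), hqd]
      · have hkN := le_of_le (show k ≤ n by omega) hn
        have hdk := hp.natDegree k hkN
        have d1 := natDegree_mul_le (p := q) (q := p k)
        have d2 := natDegree_mul_le (p := p m) (q := p k)
        have d3 := natDegree_C_mul_le c (p m * p k)
        rw [sub_mul, mul_assoc, hV.moment_sub hM (by omega) (by omega), moment_C_mul]
        rcases (Nat.lt_succ_iff.1 hk).eq_or_lt with rfl | hk
        · rw [hc, div_mul_cancel₀ _ (moment_self_pos hV hp hkN).ne', sub_self]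
        · rw [hqo k hk, hp.moment_eq_zero hmN hkN hk.ne']
          ring
  obtain ⟨q, hq, hqd, hqo⟩ := main n le_rfl
  exact ⟨q, hq, hqd, hqo, fun h => absurd h hN⟩

/-- Integration by parts moves the derivative onto `p k`, producing a polynomial of degree at most
`k + 1 < n`, orthogonal to `p n`. -/
theorem moment_mul_derivative_eq_zero (hV : IsPearsonWeight f g V I)
    (hp : IsMonicOrthogonal I V N p) (hn : (n : ℕ∞) ≤ N) {k : ℕ} (hk : k + 1 < n) :
    moment I V (f * derivative (p n) * p k) = 0 := by
  have hM := hp.hasMoments hn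
  have hkN := le_of_le (show k ≤ n by omega) hn
  have hdk := hp.natDegree k hkN
  have hdn := hp.natDegree n hn
  have d0 := natDegree_mul_le (p := p n) (q := p k)
  have h1 := hV.moment_pearson hM (φ := p n * p k) (by omega)
  have hP := hV.natDegree_pearson_le (p k)
  have h2 : moment I V (p n * (f * derivative (p k) + (derivative f - g) * p k)) = 0 := by
    refine moment_mul_eq_zero hV hp hn ?_
    refine (degree_lt_iff_coeff_zero _ _).2 fun i hi => coeff_eq_zero_of_natDegree_lt ?_
    omega
  have e : f * derivative (p n * p k) + (derivative f - g) * (p n * p k) =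
      f * derivative (p n) * p k +
        p n * (f * derivative (p k) + (derivative f - g) * p k) := by
    rw [derivative_mul]; ring
  have d1 := (hV.natDegree_wronskian_le (p n) (p k)).2
  have d2 := natDegree_mul_le (p := p n)
    (q := f * derivative (p k) + (derivative f - g) * p k)
  rw [e, hV.moment_add hM (by omega) (by omega), h2, add_zero] at h1
  exact h1

theorem exists_structure (hV : IsPearsonWeight f g V I) (hp : IsMonicOrthogonal I V N p)
    (hn : (n : ℕ∞) ≤ N) :
    ∃ a b c : ℝ, ∃ q : ℝ[X], q.Monic ∧ q.natDegree = n + 1 ∧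
      (∀ k < n, moment I V (q * p k) = 0) ∧ (((n + 1 : ℕ) : ℕ∞) ≤ N → q = p (n + 1)) ∧
      f * derivative (p n) = C a * q + C b * p n + C c * prev p n := by
  obtain ⟨q, hq, hqd, hqo, hqN⟩ := exists_next hV hp hn
  have hM := hp.hasMoments hn
  have hd := natDegree_mul_derivative_le hV.natDegree_f (p n)
  rw [hp.natDegree n hn] at hd
  have hlt := degree_sub_C_mul_lt hd hq hqd
  have key := eq_add_of_orthogonal hV hp hn hlt fun k hk => by
    have hkN := le_of_le (show k ≤ n by omega) hn
    have hdk := hp.natDegree k hkN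
    have d1 := natDegree_mul_le (p := f * derivative (p n)) (q := p k)
    have d2 := natDegree_mul_le (p := q) (q := p k)
    have d3 := natDegree_C_mul_le ((f * derivative (p n)).coeff (n + 1)) (q * p k)
    rw [sub_mul, mul_assoc (C _), hV.moment_sub hM (by omega) (by omega), moment_C_mul,
      moment_mul_derivative_eq_zero hV hp hn hk, hqo k (by omega)]
    ring
  exact ⟨_, _, _, q, hq, hqd, hqo, hqN, by rw [add_assoc, ← key]; ring⟩

/-- After the leading term is removed, antisymmetry kills the components along `p k` for `k + 1 < n`
and also the one along `p n` itself. If `α` were zero, both `⟨T p_n, p_{n+1}⟩₂` and `⟨p_n, T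
p_{n+1}⟩₂` would vanish, but their difference is an integral of `f` times a positive Wronskian. -/
theorem exists_skewOp (hV : IsPearsonWeight f g V I) (hp : IsMonicOrthogonal I V N p)
    (hn : ((n + 1 : ℕ) : ℕ∞) ≤ N) :
    ∃ α γ : ℝ, α ≠ 0 ∧ skewOp f g (p n) = C α * p (n + 1) + C γ * prev p n := by
  have hn' := le_of_le (Nat.le_succ n) hn
  have hM := hp.hasMoments hn
  have hdn := hp.natDegree n hn'
  have hdn1 := hp.natDegree (n + 1) hn
  have hs := hV.natDegree_skewOp_le (p n)
  have hs1 := hV.natDegree_skewOp_le (p (n + 1))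
  rw [hdn] at hs
  rw [hdn1] at hs1
  have hlt := degree_sub_C_mul_lt hs (hp.monic _ hn) hdn1
  set α := (skewOp f g (p n)).coeff (n + 1) with hα
  have hmom : ∀ k ≤ n, moment I V ((skewOp f g (p n) - C α * p (n + 1)) * p k) =
      moment I V (skewOp f g (p n) * p k) := by
    intro k hk
    have hkN := le_of_le hk hn'
    have hdk := hp.natDegree k hkN
    have d1 := natDegree_mul_le (p := skewOp f g (p n)) (q := p k)
    have d2 := natDegree_mul_le (p := p (n + 1)) (q := p k)
    have d3 := natDegree_C_mul_le α (p (n + 1) * p k)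
    rw [sub_mul, mul_assoc (C _), hV.moment_sub hM (by omega) (by omega), moment_C_mul,
      hp.moment_eq_zero hn hkN (by omega), mul_zero, sub_zero]
  have key := eq_add_of_orthogonal hV hp hn' hlt fun k hk => by
    have hkN := le_of_le (show k ≤ n by omega) hn'
    have hdk := hp.natDegree k hkN
    rw [hmom k (by omega), hV.moment_skewOp_mul hM (by omega), neg_eq_zero]
    refine moment_mul_eq_zero hV hp hn' ?_
    have := hV.natDegree_skewOp_le (p k)
    exact (degree_lt_iff_coeff_zero _ _).2 fun i hi => coeff_eq_zero_of_natDegree_lt (by omega)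
  have hself : moment I V (skewOp f g (p n) * p n) = 0 := by
    have := hV.moment_skewOp_mul hM (φ := p n) (ψ := p n) (by omega)
    rw [mul_comm (p n)] at this
    linarith
  rw [hmom n le_rfl, hself, zero_div, C_0, zero_mul, zero_add] at key
  set γ := moment I V ((skewOp f g (p n) - C α * p (n + 1)) * prev p n) /
    moment I V (prev p n * prev p n) with hγ
  have hfin : skewOp f g (p n) = C α * p (n + 1) + C γ * prev p n := by
    rw [← key]; ring
  refine ⟨α, γ, fun h0 => ?_, hfin⟩
  have h1 : moment I V (skewOp f g (p n) * p (n + 1)) = 0 := by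
    rw [hfin, h0, C_0, zero_mul, zero_add, mul_assoc, moment_C_mul,
      hp.moment_prev_mul hn' hn (by omega), mul_zero]
  have h2 : moment I V (p n * skewOp f g (p (n + 1))) = 0 := by
    have := hV.moment_skewOp_mul hM (φ := p n) (ψ := p (n + 1)) (by omega)
    linarith
  have d1 := natDegree_mul_le (p := skewOp f g (p n)) (q := p (n + 1))
  have d2 := natDegree_mul_le (p := p n) (q := skewOp f g (p (n + 1)))
  have h3 := hV.moment_sub hM (P := p n * skewOp f g (p (n + 1)))
    (Q := skewOp f g (p n) * p (n + 1)) (by omega) (by omega)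
  have hW := wronskian_pos hV hp hn
  set W := p n * derivative (p (n + 1)) - derivative (p n) * p (n + 1) with hWdef
  have e : p n * skewOp f g (p (n + 1)) - skewOp f g (p n) * p (n + 1) = f * W := by
    rw [skewOp, skewOp, hWdef]; ring
  have hdW : (f * W).natDegree ≤ 2 * (n + 1) := by
    rw [← e]
    exact (natDegree_sub_le _ _).trans (max_le (by omega) (by omega))
  have hW0 : W ≠ 0 := fun h => by simpa [h] using hW 0
  have hpos := hV.moment_pos hM hdW (mul_ne_zero hV.f_ne_zero hW0) fun x hx => by
    rw [eval_mul]; exact mul_nonneg (hV.f_pos x hx).le (hW x).le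
  rw [e, h1, h2] at h3
  linarith

/-! ### Evaluation of the two skew inner products -/

theorem inner₄_of_lt (hV : IsPearsonWeight f g V I) (hp : IsMonicOrthogonal I V N p)
    {a b c : ℕ → ℝ} (hs : StructureRelation f I V N p a b c) {m : ℕ} (hmn : m < n)
    (hn : (n : ℕ∞) ≤ N) :
    inner₄ I (V₂ f V) (p m) (p n) = if n = m + 1 then 1 / 2 *
      (c (m + 1) * inner₂ I V (p m) (p m) - a m * inner₂ I V (p (m + 1)) (p (m + 1)))
      else 0 := by
  have hM := hp.hasMoments hn
  have hm := le_of_le hmn.le hn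
  have hm1 := le_of_le (show m + 1 ≤ n by omega) hn
  have hdn := hp.natDegree n hn
  have hdm := hp.natDegree m hm
  have hdm1 := hp.natDegree (m + 1) hm1
  obtain ⟨q, -, hqd, hqo, -, hq⟩ := hs n hn
  obtain ⟨q', -, -, -, hq', hq''⟩ := hs m hm
  rw [hq' hm1] at hq''
  have hprevn := hp.natDegree_prev_le hn
  have hprevm := hp.natDegree_prev_le hm
  have expand : ∀ (x y z : ℝ) (P Q R S : ℝ[X]), (P * S).natDegree ≤ 2 * n →
      (Q * S).natDegree ≤ 2 * n → (R * S).natDegree ≤ 2 * n →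
      moment I V ((C x * P + C y * Q + C z * R) * S) =
        x * moment I V (P * S) + y * moment I V (Q * S) + z * moment I V (R * S) := by
    intro x y z P Q R S hP hQ hR
    have d1 := natDegree_C_mul_le x (P * S)
    have d2 := natDegree_C_mul_le y (Q * S)
    have d3 := natDegree_C_mul_le z (R * S)
    rw [add_mul, add_mul, mul_assoc, mul_assoc, mul_assoc, hV.moment_add hM
      (natDegree_add_le_of_degree_le (by omega) (by omega)) (by omega),
      hV.moment_add hM (by omega) (by omega), moment_C_mul, moment_C_mul, moment_C_mul]
  have d1 := natDegree_mul_le (p := q) (q := p m)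
  have d2 := natDegree_mul_le (p := p n) (q := p m)
  have d3 := natDegree_mul_le (p := prev p n) (q := p m)
  have d4 := natDegree_mul_le (p := p (m + 1)) (q := p n)
  have d5 := natDegree_mul_le (p := p m) (q := p n)
  have d6 := natDegree_mul_le (p := prev p m) (q := p n)
  -- Orthogonality to `p k` for `k < n` is all that is used of `q`, so the top index `n = N` needs
  -- no separate treatment.
  have hq0 : moment I V (q * p m) = 0 := by
    rw [← inner₂_eq_moment]; exact hqo m hmn
  rw [hV.inner₄_eq hM (by omega), mul_comm (p m), hq, hq'', expand _ _ _ _ _ _ _ (by omega)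
    (by omega) (by omega), expand _ _ _ _ _ _ _ (by omega) (by omega) (by omega),
    hp.moment_eq_zero hn hm hmn.ne', hp.moment_eq_zero hm hn hmn.ne, hq0,
    hp.moment_prev_mul hm hn (by omega), inner₂_eq_moment, inner₂_eq_moment]
  split_ifs with h
  · subst h
    simp only [prev]
    ring
  · rw [hp.moment_prev_mul hn hm (by omega), hp.moment_eq_zero hm1 hn (by omega)]
    ring

/-- Pairing `φ` with `skewOp f g (p (2 * m + 1))` gives zero, since `φ` is orthogonal to the odd
members. As `α ≠ 0`, vanishing passes from `p (2 * m)` to `p (2 * m + 2)`. -/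
theorem inner₁_even_of (hV : IsPearsonWeight f g V I) (hp : IsMonicOrthogonal I V N p)
    (hn : (n : ℕ∞) ≤ N) {φ : ℝ[X]} (hφ : φ.natDegree ≤ n)
    (ho : ∀ i, 2 * i + 1 ≤ n → moment I V (φ * p (2 * i + 1)) = 0)
    (h0 : inner₁ I (V₁ f V) φ (p 0) = 0) {m : ℕ} (hm : 2 * m ≤ n) :
    inner₁ I (V₁ f V) φ (p (2 * m)) = 0 := by
  have hM := hp.hasMoments hn
  induction m with
  | zero => exact h0
  | succ m ih =>
    have hm2 := le_of_le (show 2 * m + 1 + 1 ≤ n by omega) hn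
    have hd1 := hp.natDegree _ (le_of_le (show 2 * m + 1 ≤ n by omega) hn)
    have hd0 := hp.natDegree _ (le_of_le (show 2 * m ≤ n by omega) hn)
    have hd2 := hp.natDegree _ hm2
    obtain ⟨α, γ, hα, hs⟩ := exists_skewOp hV hp hm2
    have h1 := hV.inner₁_skewOp hM hφ (ψ := p (2 * m + 1)) (by omega)
    have d1 := natDegree_C_mul_le α (p (2 * m + 1 + 1))
    have d2 := natDegree_C_mul_le γ (p (2 * m))
    simp only [prev] at hs
    rw [hs, ho m (by omega), hV.inner₁_add_right hM hφ (by omega) (by omega),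
      IsPearsonWeight.inner₁_C_mul_right, IsPearsonWeight.inner₁_C_mul_right,
      ih (by omega), mul_zero, add_zero, neg_zero] at h1
    exact (mul_eq_zero.1 h1).resolve_left hα

theorem inner₁_even_even (hV : IsPearsonWeight f g V I) (hp : IsMonicOrthogonal I V N p)
    {m n : ℕ} (hm : ((2 * m : ℕ) : ℕ∞) ≤ N) (hn : ((2 * n : ℕ) : ℕ∞) ≤ N) :
    inner₁ I (V₁ f V) (p (2 * m)) (p (2 * n)) = 0 := by
  have hzero : inner₁ I (V₁ f V) (p 0) (p 0) = 0 := by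
    have := IsPearsonWeight.inner₁_swap I (V₁ f V) (p 0) (p 0)
    linarith
  have horth : ∀ k i M : ℕ, (M : ℕ∞) ≤ N → 2 * k ≤ M → 2 * i + 1 ≤ M →
      moment I V (p (2 * k) * p (2 * i + 1)) = 0 := fun k i M hM hk hi =>
    hp.moment_eq_zero (le_of_le hk hM) (le_of_le hi hM) (by omega)
  -- The induction is used twice: with `φ = p 0`, started by antisymmetry, and then with `φ = p (2 *
  -- m)`, started by swapping the first result.
  have h1 : inner₁ I (V₁ f V) (p 0) (p (2 * m)) = 0 :=
    inner₁_even_of hV hp hm (by rw [hp.natDegree 0 (by simp)]; omega)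
      (fun i hi => horth 0 i _ hm (by omega) hi) hzero le_rfl
  have h2 : inner₁ I (V₁ f V) (p (2 * m)) (p 0) = 0 := by
    rw [IsPearsonWeight.inner₁_swap, h1, neg_zero]
  have hmax : ((max (2 * m) (2 * n) : ℕ) : ℕ∞) ≤ N := by
    rcases max_cases (2 * m) (2 * n) with h | h <;> rw [h.1] <;> assumption
  exact inner₁_even_of hV hp hmax (by rw [hp.natDegree _ hm]; exact le_max_left _ _)
    (fun i hi => horth m i _ hmax (le_max_left _ _) hi) h2 (le_max_right _ _)

theorem natDegree_oddPoly_le (hp : IsMonicOrthogonal I V N p) (ζ : ℕ → ℝ)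
    (hn : ((2 * n + 1 : ℕ) : ℕ∞) ≤ N) : (oddPoly p ζ n).natDegree ≤ 2 * n + 1 := by
  have h1 := hp.natDegree_prev_le (le_of_le (Nat.le_succ (2 * n)) hn)
  have h2 := natDegree_C_mul_le (ζ n) (prev p (2 * n))
  exact (natDegree_sub_le _ _).trans (max_le (hp.natDegree _ hn).le (by omega))

/-- This choice of `ζ` makes `oddPoly p ζ n` equal to `α⁻¹ • skewOp f g (p (2 * n))`, so that
`inner₁_skewOp` applies. -/
theorem inner₁_oddPoly (hV : IsPearsonWeight f g V I) (hp : IsMonicOrthogonal I V N p)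
    {α γ : ℝ} (hα : α ≠ 0) {ζ : ℕ → ℝ} (hζ : ζ n = -γ / α)
    (hs : skewOp f g (p (2 * n)) = C α * p (2 * n + 1) + C γ * prev p (2 * n))
    (hn : ((2 * n + 1 : ℕ) : ℕ∞) ≤ N) {k : ℕ} (hk : (k : ℕ∞) ≤ N) {φ : ℝ[X]}
    (hφ : φ.natDegree ≤ k) :
    inner₁ I (V₁ f V) φ (oddPoly p ζ n) = -moment I V (φ * p (2 * n)) / α := by
  have hmax : ((max k (2 * n + 1) : ℕ) : ℕ∞) ≤ N := by
    rcases max_cases k (2 * n + 1) with h | h <;> rw [h.1] <;> assumption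
  have hodd : oddPoly p ζ n = C α⁻¹ * skewOp f g (p (2 * n)) := by
    have hC : (C α⁻¹ : ℝ[X]) * C α = 1 := by rw [← C_mul, inv_mul_cancel₀ hα, C_1]
    rw [oddPoly, hζ, hs, show -γ / α = -(α⁻¹ * γ) by ring, C_neg, C_mul]
    linear_combination (-p (2 * n + 1)) * hC
  rw [hodd, IsPearsonWeight.inner₁_C_mul_right,
    hV.inner₁_skewOp (hp.hasMoments hmax) (hφ.trans (le_max_left _ _))]
  · ring
  · rw [hp.natDegree _ (le_of_le (Nat.le_succ (2 * n)) hn)]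
    exact le_max_right _ _

end IsMonicOrthogonal

end ClassicalSkew

/-! ### Assembling the relations -/

open ClassicalSkew IsMonicOrthogonal

theorem proposition4 (f g : Polynomial ℝ) (V : ℝ → ℝ) (I : Set ℝ) (N : ℕ∞)
    (p : ℕ → Polynomial ℝ)
    (hV : ClassicalSkew.IsPearsonWeight f g V I)
    (hp : ClassicalSkew.IsMonicOrthogonal I V N p) :
    (∀ m n : ℕ, (m : ℕ∞) ≤ N → (n : ℕ∞) ≤ N →
      IntegrableOn (ClassicalSkew.integrand₁ (ClassicalSkew.V₁ f V) (p m) (p n)) (I ×ˢ I) ∧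
      IntegrableOn (ClassicalSkew.integrand₄ (ClassicalSkew.V₂ f V) (p m) (p n)) I) ∧
    ∃ a b c : ℕ → ℝ, ClassicalSkew.StructureRelation f I V N p a b c ∧
      ∃ ζ h₁ : ℕ → ℝ,
        ClassicalSkew.SkewRelations
          (ClassicalSkew.inner₁ I (ClassicalSkew.V₁ f V))
          (ClassicalSkew.inner₄ I (ClassicalSkew.V₂ f V)) N p ζ h₁
          (fun j => 1 / 2 *
            (c (j + 1) * ClassicalSkew.inner₂ I V (p j) (p j) -
              a j * ClassicalSkew.inner₂ I V (p (j + 1)) (p (j + 1)))) := by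
  constructor
  · intro m n hm hn
    have hmax : ((max m n : ℕ) : ℕ∞) ≤ N := by
      rcases max_cases m n with h | h <;> rw [h.1] <;> assumption
    have hM := hp.hasMoments hmax
    have hdm := hp.natDegree m hm
    have hdn := hp.natDegree n hn
    refine ⟨hV.integrableOn_integrand₁ hM (by omega) (by omega), ?_⟩
    -- On the diagonal the degree bound would be `2 n + 1`, one too many for the moments, but there
    -- the integrand vanishes identically.
    by_cases hmn : m = n
    · subst hmn
      have : integrand₄ (V₂ f V) (p m) (p m) = fun _ => 0 := by
        ext x
        rw [integrand₄]; ring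
      rw [this]
      exact integrableOn_zero
    · exact hV.integrableOn_integrand₄ hM (by omega)
  -- Sequences indexed by all of `ℕ` are chosen, with zero as a default beyond `N`.
  have hex : ∀ n : ℕ, ∃ a b c : ℝ, (n : ℕ∞) ≤ N → ∃ q : ℝ[X], q.Monic ∧ q.natDegree = n + 1 ∧
      (∀ k < n, moment I V (q * p k) = 0) ∧ (((n + 1 : ℕ) : ℕ∞) ≤ N → q = p (n + 1)) ∧
      f * derivative (p n) = C a * q + C b * p n + C c * prev p n := by
    intro n
    by_cases hn : (n : ℕ∞) ≤ N
    · obtain ⟨a, b, c, h⟩ := exists_structure hV hp hn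
      exact ⟨a, b, c, fun _ => h⟩
    · exact ⟨0, 0, 0, fun h => absurd h hn⟩
  choose a b c habc using hex
  have hs : StructureRelation f I V N p a b c := by
    intro n hn
    obtain ⟨q, h1, h2, h3, h4⟩ := habc n hn
    exact ⟨q, h1, h2, fun k hk => by rw [inner₂_eq_moment]; exact h3 k hk, h4⟩
  refine ⟨a, b, c, hs, ?_⟩
  have hex2 : ∀ n : ℕ, ∃ α γ : ℝ, ((2 * n + 1 : ℕ) : ℕ∞) ≤ N →
      α ≠ 0 ∧ skewOp f g (p (2 * n)) = C α * p (2 * n + 1) + C γ * prev p (2 * n) := by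
    intro n
    by_cases hn : ((2 * n + 1 : ℕ) : ℕ∞) ≤ N
    · obtain ⟨α, γ, h⟩ := exists_skewOp hV hp hn
      exact ⟨α, γ, fun _ => h⟩
    · exact ⟨0, 0, fun h => absurd h hn⟩
  choose α γ hαγ using hex2
  have hlt := fun {m n : ℕ} (hmn : m < n) (hn : (n : ℕ∞) ≤ N) => inner₄_of_lt hV hp hs hmn hn
  have hself : ∀ φ : ℝ[X], inner₄ I (V₂ f V) φ φ = 0 := fun φ => by
    have := IsPearsonWeight.inner₄_swap I (V₂ f V) φ φ
    linarith
  have hfar : ∀ m n : ℕ, (m : ℕ∞) ≤ N → (n : ℕ∞) ≤ N → n ≠ m + 1 → m ≠ n + 1 →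
      inner₄ I (V₂ f V) (p m) (p n) = 0 := by
    intro m n hm hn h1 h2
    rcases lt_trichotomy m n with h | rfl | h
    · rw [hlt h hn, if_neg h1]
    · exact hself _
    · rw [IsPearsonWeight.inner₄_swap, hlt h hm, if_neg h2, neg_zero]
  refine ⟨fun n => -γ n / α n, fun n => -moment I V (p (2 * n) * p (2 * n)) / α n,
    ?_, ?_, ?_, ?_, ?_, ?_⟩
  · intro m n hm hn
    obtain ⟨h1, h2⟩ := hαγ n hn
    rw [inner₁_oddPoly hV hp h1 rfl h2 hn hm (hp.natDegree _ hm).le]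
    split_ifs with h
    · rw [h]
    · rw [hp.moment_eq_zero hm (le_of_le (Nat.le_succ _) hn) (by omega), neg_zero, zero_div]
  · intro m n hm hn
    exact inner₁_even_even hV hp hm hn
  · intro m n hm hn
    obtain ⟨h1, h2⟩ := hαγ m hm
    have hm' := le_of_le (Nat.le_succ (2 * m)) hm
    have hn' := le_of_le (Nat.le_succ (2 * n)) hn
    -- What is left is the moment of an odd polynomial against `p (2 * m)`, which vanishes by parity
    -- of the indices.
    rw [inner₁_oddPoly hV hp h1 rfl h2 hm hn (natDegree_oddPoly_le hp _ hn)]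
    have hmax : ((max (2 * n + 1) (2 * m) : ℕ) : ℕ∞) ≤ N := by
      rcases max_cases (2 * n + 1) (2 * m) with h | h <;> rw [h.1] <;> assumption
    have d1 := natDegree_mul_le (p := p (2 * n + 1)) (q := p (2 * m))
    have d2 := natDegree_mul_le (p := prev p (2 * n)) (q := p (2 * m))
    have d3 := natDegree_C_mul_le (-γ n / α n) (prev p (2 * n) * p (2 * m))
    have d4 := hp.natDegree_prev_le hn'
    rw [hp.natDegree _ hn, hp.natDegree _ hm'] at d1
    rw [hp.natDegree _ hm'] at d2
    rw [oddPoly, sub_mul, mul_assoc, hV.moment_sub (hp.hasMoments hmax) (by omega) (by omega),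
      moment_C_mul, hp.moment_eq_zero hn hm' (by omega),
      hp.moment_prev_mul hn' hm' (by omega)]
    simp
  · intro m n hm hn
    rcases lt_trichotomy m (n + 1) with h | h | h
    · rw [hlt (show 2 * m < 2 * n + 1 by omega) hn, if_neg (show ¬ m = n + 1 by omega), sub_zero]
      by_cases hnm : n = m
      · subst hnm
        simp
      · rw [if_neg hnm, if_neg (by omega)]
    · subst h
      rw [IsPearsonWeight.inner₄_swap, hlt (show 2 * n + 1 < 2 * (n + 1) by omega) hm,
        if_pos (by ring), if_neg (by omega), if_pos rfl, zero_sub]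
      -- The truncated subtraction `2 * (n + 1) - 1` reduces to `2 * n + 1`.
      rfl
    · rw [hfar _ _ hm hn (by omega) (by omega), if_neg (by omega), if_neg (by omega), sub_zero]
  · intro m n hm hn
    exact hfar _ _ hm hn (by omega) (by omega)
  · intro m n hm hn
    exact hfar _ _ hm hn (by omega) (by omega)
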